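/- Let $(M,g)$ be a four-dimensional smooth spacetime of signature $(-,+,+,+)$ (units with $c=1$), and let $T=(\rho+p)\,u\otimes u+p\,g$ be a conservative perfect energy tensor, $\nabla\cdot T=0$, with smooth unit velocity $u$, $g(u,u)=-1$, energy density $\rho>0$ and pressure $p>0$. Assume that $T$ is non barotropic, i.e. $d\rho\wedge dp\neq 0$ everywhere. Write $\pi=p/\rho$, and write $\dot q=u(q)$ for the derivative of a scalar $q$ along $u$. Fix a constant $k>0$. A generic ideal gas is given by smooth functions of state $r(\rho,p)>0$ (matter density), $s(\rho,p)$ (specific entropy) and $\Theta(\rho,p)>0$ (temperature) on an open domain $D$ of the thermodynamic plane $\{(\rho,p):\rho>0\}$ that meets every ray $p=c\rho$ in a connected set, satisfying the energy balance $\Theta\,ds=d\epsilon+p\,dv$, where $v=1/r$ and $\rho=r(1+\epsilon)$, and the equation of state $p=k\,r\,\Theta$. The relativistic compressibility conditions are $$\mathrm H_1:\ (\tau'_p)_s<0,\quad (\tau''_p)_s>0;\qquad \mathrm H_2:\ (\tau'_s)_p>0$$ on $D$, where $\tau=(1+\epsilon+pv)\,v$ is the dynamic volume and $(s,p)$ are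 coordinates, i.e. $ds\wedge dp\neq0$ on $D$. The gas is one whose evolution $T$ represents in local thermal equilibrium if the states $(\rho,p)$ of $T$ lie in $D$ and, on $M$, $\dot r+r\,\nabla_\alpha u^\alpha=0$ and $\dot s=0$. The square of the speed of sound of the gas is the function of state $\chi=-s'_\rho/s'_p$. For a set $J$ of values of $\pi$, say that a function $\chi(\pi)$ satisfies (C) on $J$ if it is smooth on $J$ and, on $J$, $$\chi(\pi)\neq\pi,\qquad \frac{\pi}{2\pi+1}<\chi<1,\qquad (1+\pi)(\chi-\pi)\chi'+2\chi(1-\chi)>0 .$$ (i) If $T$ is non isoenergetic ($\dot\rho\neq0$ everywhere), then $T$ represents the evolution in local thermal equilibrium of a generic ideal gas satisfying $\mathrm H_1$ and $\mathrm H_2$ if and only if the indicatrix $\dot p/\dot\rho$ is a function $\chi(\pi)$ of $\pi$ alone that satisfies (C) on the range of $\pi$ on $M$. (ii) If $T$ is isoenergetic ($\dot\rho=0$ everywhere), then $T$ represents the evolution in local thermal equilibrium of a generic ideal gas satisfying $\mathrm H_1$ and $\mathrm H_2$ if and only if $T$ is isobaroenergetic, $\dot\rho=\dot p=0$. In that case,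 a generic ideal gas satisfies $\mathrm H_1$ and $\mathrm H_2$ and is one whose evolution $T$ represents if and only if its domain $D$ contains the states $(\rho,p)$ of $T$ and the square of its speed of sound is well defined on $D$ (i.e. $s'_p\neq0$) and is a function $\chi(\pi)$ of $\pi$ alone that satisfies (C) on the set of values of $p/\rho$ on $D$. -/

import Mathlib

open scoped Manifold ContDiff

noncomputable section

namespace RelFluid

/-! ### Spacetime -/

/-- The model space of a four-dimensional spacetime. -/
abbrev E4 : Type := EuclideanSpace ℝ (Fin 4)

/-- The `i`-th vector of the standard basis of the model space. -/
def e4 (i : Fin 4) : E4 := EuclideanSpace.single i 1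

/-- A smooth metric tensor of signature `(-,+,+,+)` on a four-dimensional manifold. -/
structure LorentzMetric (M : Type*) [TopologicalSpace M] [ChartedSpace E4 M]
    [IsManifold (𝓡 4) ∞ M] where
  /-- The metric as a bilinear form on every tangent space. -/
  val (x : M) : TangentSpace (𝓡 4) x →L[ℝ] TangentSpace (𝓡 4) x →L[ℝ] ℝ
  symm (x : M) (v w : TangentSpace (𝓡 4) x) : val x v w = val x w v
  /-- There is a tetrad with `g(b 0, b 0) = -1`, `g(b i, b i) = 1` for `i ≠ 0`, and vanishing
  mixed products. -/
  signature (x : M) : ∃ b : Fin 4 → TangentSpace (𝓡 4) x, ∀ i j : Fin 4,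
    val x (b i) (b j) = if i = j then (if i = 0 then -1 else 1) else 0
  smooth : ContMDiff (𝓡 4) ((𝓡 4).prod 𝓘(ℝ, E4 →L[ℝ] E4 →L[ℝ] ℝ)) ∞
    (fun x : M => (Bundle.TotalSpace.mk' (E4 →L[ℝ] E4 →L[ℝ] ℝ) x (val x) :
      Bundle.TotalSpace (E4 →L[ℝ] E4 →L[ℝ] ℝ)
        (fun x : M => TangentSpace (𝓡 4) x →L[ℝ] TangentSpace (𝓡 4) x →L[ℝ] ℝ)))

section Charts

variable {M : Type*} [TopologicalSpace M] [ChartedSpace E4 M] [IsManifold (𝓡 4) ∞ M]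

/-- The differential `df` of a scalar at `x`. -/
def differential (f : M → ℝ) (x : M) : TangentSpace (𝓡 4) x →L[ℝ] ℝ :=
  mfderiv (𝓡 4) 𝓘(ℝ, ℝ) f x

/-- The derivative of the scalar `f` along the vector field `u`, at `x`. -/
def dot (u : (x : M) → TangentSpace (𝓡 4) x) (f : M → ℝ) (x : M) : ℝ :=
  differential f x (u x)

/-- The partial derivative in the `a`-th coordinate of a function of the coordinates. -/
def pd (a : Fin 4) (f : E4 → ℝ) (y : E4) : ℝ := fderiv ℝ f y (e4 a)

/-- The point of `M` that has the coordinates `y` in the chart around `x₀`. -/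
def pt (x₀ : M) (y : E4) : M := (extChartAt (𝓡 4) x₀).symm y

/-- The coordinate vector field `∂_i` of the chart around `x₀`, at the coordinates `y`. -/
def coordVec (x₀ : M) (i : Fin 4) (y : E4) : TangentSpace (𝓡 4) (pt x₀ y) :=
  mfderiv 𝓘(ℝ, E4) (𝓡 4) (extChartAt (𝓡 4) x₀).symm y (e4 i)

/-- The components `v^i` of a vector field in the chart around `x₀`. -/
def vecComp (x₀ : M) (v : (x : M) → TangentSpace (𝓡 4) x) (i : Fin 4) (y : E4) : ℝ :=
  (show E4 from mfderiv (𝓡 4) 𝓘(ℝ, E4) (extChartAt (𝓡 4) x₀) (pt x₀ y) (v (pt x₀ y))) i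

/-- The matrix of the components `g_{ij}` of the metric in the chart around `x₀`. -/
def metricComp (g : LorentzMetric M) (x₀ : M) (y : E4) : Matrix (Fin 4) (Fin 4) ℝ :=
  Matrix.of fun i j => g.val (pt x₀ y) (coordVec x₀ i y) (coordVec x₀ j y)

/-- The Christoffel symbols `Γ^a_{bc}` of the metric in the chart around `x₀`. -/
def christoffel (g : LorentzMetric M) (x₀ : M) (a b c : Fin 4) (y : E4) : ℝ :=
  (1 / 2) * ∑ d, (metricComp g x₀ y)⁻¹ a d *
    (pd b (fun z => metricComp g x₀ z d c) y + pd c (fun z => metricComp g x₀ z d b) y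
      - pd d (fun z => metricComp g x₀ z b c) y)

/-- The expansion `θ = ∇_a v^a` of a vector field, at `x`. -/
def expansion (g : LorentzMetric M) (v : (x : M) → TangentSpace (𝓡 4) x) (x : M) : ℝ :=
  ∑ a, pd a (vecComp x v a) (extChartAt (𝓡 4) x x)
    + ∑ a, ∑ c, christoffel g x a a c (extChartAt (𝓡 4) x x)
        * vecComp x v c (extChartAt (𝓡 4) x x)

/-- The mixed components `T^a_b = (ρ + p) u^a u_b + p δ^a_b` of the perfect energy tensor
`T = (ρ + p) u ⊗ u + p g` in the chart around `x₀`. -/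
def energyComp (g : LorentzMetric M) (u : (x : M) → TangentSpace (𝓡 4) x) (ρ p : M → ℝ)
    (x₀ : M) (a b : Fin 4) (y : E4) : ℝ :=
  (ρ (pt x₀ y) + p (pt x₀ y)) * vecComp x₀ u a y * g.val (pt x₀ y) (u (pt x₀ y)) (coordVec x₀ b y)
    + p (pt x₀ y) * (if a = b then 1 else 0)

/-- The components `(∇ · T)_b = ∇_a T^a_b` at `x` of the divergence of
`T = (ρ + p) u ⊗ u + p g`, in the chart around `x`. -/
def divEnergy (g : LorentzMetric M) (u : (x : M) → TangentSpace (𝓡 4) x) (ρ p : M → ℝ)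
    (x : M) (b : Fin 4) : ℝ :=
  ∑ a, pd a (energyComp g u ρ p x a b) (extChartAt (𝓡 4) x x)
    + ∑ a, ∑ c, christoffel g x a a c (extChartAt (𝓡 4) x x)
        * energyComp g u ρ p x c b (extChartAt (𝓡 4) x x)
    - ∑ a, ∑ c, christoffel g x c a b (extChartAt (𝓡 4) x x)
        * energyComp g u ρ p x a c (extChartAt (𝓡 4) x x)

end Charts

/-! ### Perfect energy tensors -/

/-- A conservative perfect energy tensor `T = (ρ + p) u ⊗ u + p g`, with smooth unit velocity `u`,
positive energy density `ρ` and positive pressure `p`. -/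
structure PerfectEnergyTensor (M : Type*) [TopologicalSpace M] [ChartedSpace E4 M]
    [IsManifold (𝓡 4) ∞ M] (g : LorentzMetric M) where
  u : (x : M) → TangentSpace (𝓡 4) x
  ρ : M → ℝ
  p : M → ℝ
  smooth_u : ContMDiff (𝓡 4) (𝓡 4).tangent ∞
    (fun x : M => (⟨x, u x⟩ : TangentBundle (𝓡 4) M))
  smooth_ρ : ContMDiff (𝓡 4) 𝓘(ℝ, ℝ) ∞ ρ
  smooth_p : ContMDiff (𝓡 4) 𝓘(ℝ, ℝ) ∞ p
  unit (x : M) : g.val x (u x) (u x) = -1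
  ρ_pos (x : M) : 0 < ρ x
  p_pos (x : M) : 0 < p x
  conservation (x : M) (b : Fin 4) : divEnergy g u ρ p x b = 0

/-! ### Thermodynamics in the plane of the hydrodynamic quantities `(ρ, p)` -/

/-- The derivative of a function of state in the direction of `ρ`, at fixed `p`. -/
def dRho (z : ℝ × ℝ → ℝ) (q : ℝ × ℝ) : ℝ := fderiv ℝ z q (1, 0)

/-- The derivative of a function of state in the direction of `p`, at fixed `ρ`. -/
def dP (z : ℝ × ℝ → ℝ) (q : ℝ × ℝ) : ℝ := fderiv ℝ z q (0, 1)

/-- Functions of state of a fluid on a domain of the thermodynamic plane, the points of which are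
the pairs `(ρ, p)`: matter density `r`, specific entropy `s` and temperature `Θ`. -/
structure StateFunctions where
  domain : Set (ℝ × ℝ)
  r : ℝ × ℝ → ℝ
  s : ℝ × ℝ → ℝ
  Θ : ℝ × ℝ → ℝ

namespace StateFunctions

variable (G : StateFunctions)

/-- The specific volume `v = 1 / r`. -/
def vol (q : ℝ × ℝ) : ℝ := 1 / G.r q

/-- The specific internal energy `ε`, defined by `ρ = r (1 + ε)`. -/
def energy (q : ℝ × ℝ) : ℝ := q.1 / G.r q - 1

/-- The specific enthalpy `i = ε + p v`. -/
def enthalpy (q : ℝ × ℝ) : ℝ := G.energy q + q.2 * G.vol q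

/-- The dynamic volume `τ = f v`, with the enthalpy index `f = 1 + i` (units with `c = 1`). -/
def dynVol (q : ℝ × ℝ) : ℝ := (1 + G.enthalpy q) * G.vol q

/-- A thermodynamics in local thermal equilibrium: smooth functions of state with positive energy
density, matter density and temperature that satisfy the energy balance `Θ ds = dε + p dv`. -/
structure IsLTE : Prop where
  isOpen_domain : IsOpen G.domain
  smooth_r : ContDiffOn ℝ ∞ G.r G.domain
  smooth_s : ContDiffOn ℝ ∞ G.s G.domain
  smooth_Θ : ContDiffOn ℝ ∞ G.Θ G.domain
  ρ_pos : ∀ q ∈ G.domain, 0 < q.1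
  r_pos : ∀ q ∈ G.domain, 0 < G.r q
  Θ_pos : ∀ q ∈ G.domain, 0 < G.Θ q
  balance : ∀ q ∈ G.domain,
    G.Θ q • fderiv ℝ G.s q = fderiv ℝ G.energy q + q.2 • fderiv ℝ G.vol q

/-- A generic ideal gas: a thermodynamics in l.t.e. with the equation of state `p = k r Θ`. Its
domain meets every ray `p = c ρ` in a connected set, so that "function of `p / ρ`" has the same
meaning locally and on the whole domain. -/
structure IsIdealGas (k : ℝ) : Prop extends G.IsLTE where
  eos : ∀ q ∈ G.domain, q.2 = k * G.r q * G.Θ q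
  rays_connected : ∀ c : ℝ, IsPreconnected {q : ℝ × ℝ | q ∈ G.domain ∧ q.2 = c * q.1}

/-- The specific entropy and the pressure are coordinates in the thermodynamic plane:
`ds ∧ dp ≠ 0`. -/
def EntropyPressureCoords : Prop :=
  ∀ q ∈ G.domain, LinearIndependent ℝ ![fderiv ℝ G.s q, ContinuousLinearMap.snd ℝ ℝ ℝ]

/-- `zs` and `zp` are the partial derivatives `(z'_s)_p` and `(z'_p)_s` of the function of state
`z` in the coordinates `(s, p)`: `dz = (z'_s)_p ds + (z'_p)_s dp`. -/
def HasPartials (z zs zp : ℝ × ℝ → ℝ) : Prop :=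
  ∀ q ∈ G.domain, HasFDerivAt z
    (zs q • fderiv ℝ G.s q + zp q • ContinuousLinearMap.snd ℝ ℝ ℝ) q

/-- The relativistic compressibility conditions
`H₁ : (τ'_p)_s < 0, (τ''_p)_s > 0` and `H₂ : (τ'_s)_p > 0`, for the dynamic volume `τ` as a
function of `(s, p)`. -/
def SatisfiesH1H2 : Prop :=
  G.EntropyPressureCoords ∧
  ∃ τs τp τps τpp : ℝ × ℝ → ℝ,
    G.HasPartials G.dynVol τs τp ∧ G.HasPartials τp τps τpp ∧
    (∀ q ∈ G.domain, τp q < 0 ∧ 0 < τpp q) ∧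
    (∀ q ∈ G.domain, 0 < τs q)

/-- The square of the speed of sound is a well-defined function of state,
`χ = - s'_ρ / s'_p` with `s'_p ≠ 0`, and has the values `χ`. -/
def HasSqSoundSpeed (χ : ℝ × ℝ → ℝ) : Prop :=
  ∀ q ∈ G.domain, dP G.s q ≠ 0 ∧ χ q = - dRho G.s q / dP G.s q

end StateFunctions

/-- The constraints on a function `χ(π)` on a set `J` of values of `π`:
`χ` is smooth on `J`, `χ(π) ≠ π`, `π / (2 π + 1) < χ < 1` and
`(1 + π) (χ - π) χ' + 2 χ (1 - χ) > 0`. -/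
def IdealGasConstraints (χ : ℝ → ℝ) (J : Set ℝ) : Prop :=
  ContDiffOn ℝ ∞ χ J ∧ ∀ t ∈ J, χ t ≠ t ∧ t / (2 * t + 1) < χ t ∧ χ t < 1 ∧
    0 < (1 + t) * (χ t - t) * deriv χ t + 2 * χ t * (1 - χ t)

namespace PerfectEnergyTensor

variable {M : Type*} [TopologicalSpace M] [ChartedSpace E4 M] [IsManifold (𝓡 4) ∞ M]
  {g : LorentzMetric M} (T : PerfectEnergyTensor M g)

/-- The state `(ρ, p)` of the fluid at an event. -/
def state (x : M) : ℝ × ℝ := (T.ρ x, T.p x)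

/-- The hydrodynamic variable `π = p / ρ`. -/
def pi (x : M) : ℝ := T.p x / T.ρ x

/-- The energy tensor is non barotropic: `dρ ∧ dp ≠ 0` everywhere. -/
def NonBarotropic : Prop :=
  ∀ x, LinearIndependent ℝ ![differential T.ρ x, differential T.p x]

/-- The energy tensor is isoenergetic: the derivative of `ρ` along `u` vanishes. -/
def Isoenergetic : Prop := ∀ x, dot T.u T.ρ x = 0

/-- The energy tensor is non isoenergetic: the derivative of `ρ` along `u` vanishes nowhere. -/
def NonIsoenergetic : Prop := ∀ x, dot T.u T.ρ x ≠ 0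

/-- The energy tensor is isobaroenergetic: the derivatives of `ρ` and `p` along `u` vanish. -/
def Isobaroenergetic : Prop := ∀ x, dot T.u T.ρ x = 0 ∧ dot T.u T.p x = 0

/-- The indicatrix of local thermal equilibrium: the quotient of the derivatives of `p` and `ρ`
along `u`. -/
def indicatrix (x : M) : ℝ := dot T.u T.p x / dot T.u T.ρ x

/-- The energy tensor is an evolution of the fluid with the functions of state `G`: the states lie
in the domain of `G`, matter is conserved, `r˙ + r θ = 0`, and the evolution is locally adiabatic,
`s˙ = 0`. -/
structure IsEvolutionOf (G : StateFunctions) : Prop where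
  state_mem : ∀ x, T.state x ∈ G.domain
  matter : ∀ x, dot T.u (fun y => G.r (T.state y)) x + G.r (T.state x) * expansion g T.u x = 0
  adiabatic : ∀ x, dot T.u (fun y => G.s (T.state y)) x = 0

/-- The energy tensor represents the l.t.e. evolution of a generic ideal gas (with the constant
`k`) that satisfies `H₁` and `H₂`. -/
def RepresentsIdealGas (k : ℝ) : Prop :=
  ∃ G : StateFunctions, G.IsIdealGas k ∧ G.SatisfiesH1H2 ∧ T.IsEvolutionOf G

end PerfectEnergyTensor

end RelFluid

end

namespace RelFluid

/-! ### Charts, components and the energy equation -/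

section Geometry

open Filter Topology Bundle

variable {M : Type*} [TopologicalSpace M] [ChartedSpace E4 M] [IsManifold (𝓡 4) ∞ M]

/-! Everything reduces to one function of `π = p/ρ`. With `p = k r Θ` the energy balance becomes
`(p/k) ds + (ρ + p) d(log r) = dρ` (`balance_log`). Its exterior derivative, with `d log r`
eliminated, is the Euler relation `ρ s'_ρ + p s'_p = -k` (`euler`), so `s + k log ρ` is constant
along rays and `s = φ(π) - k log ρ` (`exists_entropy_profile`). Hence `χ = π + k/φ'` wherever `φ' ≠
0`; since `k > 0`, this is where `χ ≠ π` comes from.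

The dynamic volume is `τ = (ρ + p)/r²`, and `(ρ'_p)_s = 1/χ`. Up to positive factors, `τ'_p`, `τ'_s`
and `τ''_p` are `1 - 1/χ`, `((2π + 1)χ - π)/χ` and `((1 + π)(χ - π)χ' + 2χ(1 - χ))/χ³`. Thus H₁ and
H₂ say exactly that `χ` is a function of `π` satisfying (C) (`satisfiesH1H2_iff`).

On the spacetime side, projecting `∇·T = 0` on `u` gives `ρ̇ + (ρ + p)θ = 0` (`energy_equation`).
With `balance_log` evaluated on `u`, `ṡ = 0` then implies conservation of matter, so an evolution
amounts to `s'_ρ ρ̇ + s'_p ṗ = 0`: `ṗ/ρ̇ = χ(π)` if `ρ̇ ≠ 0`, and `ṗ = 0` if `ρ̇ = 0`. Conversely, a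
given `χ` yields a gas by integrating `φ' = k/(χ - π)` and the corresponding equation for `r`
(`exists_idealGas`). In case (i) this needs the range of `π` to be open, which is what
non-barotropicity provides (`isOpen_range_pi`). -/

theorem E4.eq_sum_single (w : E4) : w = ∑ i, w i • e4 i := by
  ext j
  simp [e4, Fin.sum_univ_four]
  fin_cases j <;> simp

omit [IsManifold (𝓡 4) ∞ M] in
theorem pt_extChartAt (x : M) : pt x (extChartAt (𝓡 4) x x) = x :=
  extChartAt_to_inv x

omit [IsManifold (𝓡 4) ∞ M] in
theorem pt_mem_source {x₀ : M} {y : E4} (hy : y ∈ (extChartAt (𝓡 4) x₀).target) :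
    pt x₀ y ∈ (chartAt E4 x₀).source := by
  rw [← extChartAt_source (𝓡 4)]
  exact (extChartAt (𝓡 4) x₀).map_target hy

omit [IsManifold (𝓡 4) ∞ M] in
theorem eventually_mem_target (x : M) :
    ∀ᶠ y in 𝓝 (extChartAt (𝓡 4) x x), y ∈ (extChartAt (𝓡 4) x).target :=
  extChartAt_target_mem_nhds x

theorem vec_eq_sum_coordVec {x₀ : M} {y : E4} (hy : y ∈ (extChartAt (𝓡 4) x₀).target)
    (v : TangentSpace (𝓡 4) (pt x₀ y)) :
    v = ∑ i, (show E4 from mfderiv (𝓡 4) 𝓘(ℝ, E4) (extChartAt (𝓡 4) x₀) (pt x₀ y) v) i •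
      coordVec x₀ i y := by
  have h := mfderivWithin_extChartAt_symm_comp_mfderiv_extChartAt (I := 𝓡 4) hy
  rw [ModelWithCorners.range_eq_univ, mfderivWithin_univ] at h
  refine (congrArg (fun L => L v) h).symm.trans ?_
  have hw := E4.eq_sum_single
    (show E4 from mfderiv (𝓡 4) 𝓘(ℝ, E4) (extChartAt (𝓡 4) x₀) (pt x₀ y) v)
  refine (congrArg
    (fun w : E4 => mfderiv 𝓘(ℝ, E4) (𝓡 4) (extChartAt (𝓡 4) x₀).symm y w) hw).trans ?_
  exact (map_sum (mfderiv 𝓘(ℝ, E4) (𝓡 4) (extChartAt (𝓡 4) x₀).symm y) _ _).trans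
    (Finset.sum_congr rfl fun i _ => map_smul _ _ _)

theorem eq_sum_vecComp {x₀ : M} {y : E4} (hy : y ∈ (extChartAt (𝓡 4) x₀).target)
    (v : (x : M) → TangentSpace (𝓡 4) x) :
    v (pt x₀ y) = ∑ i, vecComp x₀ v i y • coordVec x₀ i y :=
  vec_eq_sum_coordVec hy _

theorem contMDiffAt_pt (x : M) :
    ContMDiffAt 𝓘(ℝ, E4) (𝓡 4) ∞ (pt x) (extChartAt (𝓡 4) x x) :=
  (contMDiffOn_extChartAt_symm x).contMDiffAt (extChartAt_target_mem_nhds x)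

theorem differentiableAt_scalar {f : M → ℝ} (hf : ContMDiff (𝓡 4) 𝓘(ℝ, ℝ) ∞ f) (x : M) :
    DifferentiableAt ℝ (fun y => f (pt x y)) (extChartAt (𝓡 4) x x) := by
  have h : ContMDiffAt 𝓘(ℝ, E4) 𝓘(ℝ, ℝ) ∞ (fun y => f (pt x y)) (extChartAt (𝓡 4) x x) :=
    hf.contMDiffAt.comp _ (contMDiffAt_pt x)
  exact h.contDiffAt.differentiableAt (by simp)

/-- Over the chart domain the trivialization of the tangent bundle is the differential of the chart,
so smoothness of the section is smoothness of these components. -/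
theorem differentiableAt_vecComp {v : (x : M) → TangentSpace (𝓡 4) x}
    (hv : ContMDiff (𝓡 4) (𝓡 4).tangent ∞ (fun x : M => (⟨x, v x⟩ : TangentBundle (𝓡 4) M)))
    (x : M) (i : Fin 4) : DifferentiableAt ℝ (vecComp x v i) (extChartAt (𝓡 4) x x) := by
  have h := (contMDiffAt_section x).1 (hv x)
  have h2 : ContMDiffAt 𝓘(ℝ, E4) 𝓘(ℝ, E4) ∞ (fun y : E4 =>
      (trivializationAt E4 (TangentSpace (𝓡 4)) x ⟨pt x y, v (pt x y)⟩).2)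
      (extChartAt (𝓡 4) x x) := by
    refine ContMDiffAt.comp (x := extChartAt (𝓡 4) x x) (g := fun z : M =>
      (trivializationAt E4 (TangentSpace (𝓡 4)) x ⟨z, v z⟩).2) (f := pt x) ?_ (contMDiffAt_pt x)
    rw [pt_extChartAt]
    exact h
  have h3 := h2.contDiffAt.differentiableAt (by simp)
  have h4 : DifferentiableAt ℝ (fun y : E4 =>
      (trivializationAt E4 (TangentSpace (𝓡 4)) x ⟨pt x y, v (pt x y)⟩).2 i)
      (extChartAt (𝓡 4) x x) :=
    (EuclideanSpace.proj (𝕜 := ℝ) i).differentiableAt.comp _ h3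
  refine h4.congr_of_eventuallyEq ?_
  filter_upwards [eventually_mem_target x] with y hy
  have hb := pt_mem_source hy
  have := congrArg (fun L => L (v (pt x y)))
    (TangentBundle.continuousLinearMapAt_trivializationAt (I := 𝓡 4) (𝕜 := ℝ) hb)
  unfold vecComp
  refine congrArg (fun w : E4 => w i) (this.symm.trans ?_)
  simp [Trivialization.continuousLinearMapAt_apply, Trivialization.linearMapAt_apply, hb]

/-- Read in the trivialization at `x`, the coordinate field is the constant vector `e4 i`. -/
theorem contMDiffAt_coordVec (x : M) (i : Fin 4) :
    ContMDiffAt 𝓘(ℝ, E4) (𝓡 4).tangent ∞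
      (fun y : E4 => (⟨pt x y, coordVec x i y⟩ : TangentBundle (𝓡 4) M))
      (extChartAt (𝓡 4) x x) := by
  rw [contMDiffAt_totalSpace]
  refine ⟨contMDiffAt_pt x, ?_⟩
  refine (contMDiffAt_const (c := e4 i)).congr_of_eventuallyEq ?_
  filter_upwards [eventually_mem_target x] with y hy
  have hb := pt_mem_source hy
  have h := mfderiv_extChartAt_comp_mfderivWithin_extChartAt_symm (I := 𝓡 4) hy
  rw [ModelWithCorners.range_eq_univ, mfderivWithin_univ] at h
  have hv := congrArg (fun L => L (e4 i)) h
  simp only [pt_extChartAt]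
  have := congrArg (fun L => L (coordVec x i y))
    (TangentBundle.continuousLinearMapAt_trivializationAt (I := 𝓡 4) (𝕜 := ℝ) hb)
  refine Eq.trans ?_ (this.trans hv)
  simp [Trivialization.continuousLinearMapAt_apply, Trivialization.linearMapAt_apply, hb]

theorem differentiableAt_metricComp (g : LorentzMetric M) (x : M) (i j : Fin 4) :
    DifferentiableAt ℝ (fun y => metricComp g x y i j) (extChartAt (𝓡 4) x x) := by
  have hg : ContMDiffAt 𝓘(ℝ, E4) ((𝓡 4).prod 𝓘(ℝ, E4 →L[ℝ] E4 →L[ℝ] ℝ)) ∞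
      (fun y : E4 => (Bundle.TotalSpace.mk' (E4 →L[ℝ] E4 →L[ℝ] ℝ) (pt x y) (g.val (pt x y)) :
      Bundle.TotalSpace (E4 →L[ℝ] E4 →L[ℝ] ℝ)
        (fun x : M => TangentSpace (𝓡 4) x →L[ℝ] TangentSpace (𝓡 4) x →L[ℝ] ℝ)))
      (extChartAt (𝓡 4) x x) :=
    (g.smooth (pt x (extChartAt (𝓡 4) x x))).comp _ (contMDiffAt_pt x)
  have h := ContMDiffAt.clm_bundle_apply₂ (F₁ := E4) (F₂ := E4) (F₃ := ℝ)
    (E₁ := fun x : M => TangentSpace (𝓡 4) x) (E₂ := fun x : M => TangentSpace (𝓡 4) x)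
    (E₃ := Bundle.Trivial M ℝ) hg (contMDiffAt_coordVec x i) (contMDiffAt_coordVec x j)
  have h2 := ((contMDiffAt_totalSpace).1 h).2
  exact h2.contDiffAt.differentiableAt (by simp)

theorem differential_coordVec {f : M → ℝ} (hf : ContMDiff (𝓡 4) 𝓘(ℝ, ℝ) ∞ f) (x : M)
    (i : Fin 4) :
    mfderiv (𝓡 4) 𝓘(ℝ, ℝ) f (pt x (extChartAt (𝓡 4) x x))
      (coordVec x i (extChartAt (𝓡 4) x x)) =
      pd i (fun y => f (pt x y)) (extChartAt (𝓡 4) x x) := by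
  have h1 : MDifferentiableAt 𝓘(ℝ, E4) (𝓡 4) (pt x) (extChartAt (𝓡 4) x x) :=
    (contMDiffAt_pt x).mdifferentiableAt (by simp)
  have h2 : MDifferentiableAt (𝓡 4) 𝓘(ℝ, ℝ) f (pt x (extChartAt (𝓡 4) x x)) :=
    hf.mdifferentiableAt (by simp)
  have h := mfderiv_comp _ h2 h1
  have h3 := congrArg (fun L => L (e4 i)) h
  rw [pd, ← mfderiv_eq_fderiv]
  exact h3.symm

theorem dot_eq_sum_pd {v : (x : M) → TangentSpace (𝓡 4) x} {f : M → ℝ}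
    (hf : ContMDiff (𝓡 4) 𝓘(ℝ, ℝ) ∞ f) (x : M) :
    dot v f x = ∑ i, vecComp x v i (extChartAt (𝓡 4) x x) *
      pd i (fun y => f (pt x y)) (extChartAt (𝓡 4) x x) := by
  have h0 : dot v f x = dot v f (pt x (extChartAt (𝓡 4) x x)) := by rw [pt_extChartAt]
  rw [h0, dot, differential, eq_sum_vecComp (mem_extChartAt_target x) v]
  refine (map_sum (mfderiv (𝓡 4) 𝓘(ℝ, ℝ) f (pt x (extChartAt (𝓡 4) x x))) _ _).trans ?_
  refine Finset.sum_congr rfl fun i _ => ?_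
  rw [map_smul, differential_coordVec hf]
  rfl

theorem metricComp_symm (g : LorentzMetric M) (x : M) (y : E4) (i j : Fin 4) :
    metricComp g x y i j = metricComp g x y j i := g.symm _ _ _

/-- If `B` holds the components of a tetrad, then `B g Bᵀ = diag(-1,1,1,1)` has nonzero determinant.
-/
theorem isUnit_det_metricComp (g : LorentzMetric M) {x : M} {y : E4}
    (hy : y ∈ (extChartAt (𝓡 4) x).target) : IsUnit (metricComp g x y).det := by
  obtain ⟨b, hb⟩ := g.signature (pt x y)
  choose B hB using fun i => (⟨_, vec_eq_sum_coordVec hy (b i)⟩ :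
    ∃ B : Fin 4 → ℝ, b i = ∑ a, B a • coordVec x a y)
  have key : Matrix.of B * metricComp g x y * (Matrix.of B).transpose =
      Matrix.diagonal fun i : Fin 4 => if i = 0 then (-1 : ℝ) else 1 := by
    ext i j
    rw [Matrix.diagonal_apply]
    refine Eq.trans ?_ (hb i j)
    rw [hB i, hB j]
    simp only [map_sum, map_smul, Matrix.mul_apply, Matrix.transpose_apply, Matrix.of_apply,
      metricComp, sum_apply, smul_apply, smul_eq_mul,
      Finset.sum_mul, Finset.mul_sum]
    exact Finset.sum_congr rfl fun a _ => Finset.sum_congr rfl fun c _ => by ring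
  have hd := congrArg Matrix.det key
  rw [Matrix.det_mul, Matrix.det_mul, Matrix.det_diagonal] at hd
  rw [isUnit_iff_ne_zero]
  intro h0
  rw [h0] at hd
  simp at hd

/-- The contraction of the divergence of `w u ⊗ u + P g` with a unit vector, in components: `dU`,
`dG`, `dw` and `dP` are the partial derivatives, the differentiation index first. -/
theorem contracted_divergence {n : Type*} [Fintype n] [DecidableEq n] {U dw dP u : n → ℝ}
    {dU du G Gi : n → n → ℝ} {dG Γ : n → n → n → ℝ} {w P : ℝ}
    (hG : ∀ a b, G a b = G b a)
    (hGi : ∀ e d, ∑ c, G e c * Gi c d = if e = d then 1 else 0)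
    (hu : ∀ b, u b = ∑ c, G c b * U c)
    (hdu : ∀ a b, du a b = ∑ c, (dG a c b * U c + G c b * dU a c))
    (hΓ : ∀ a b c, Γ a b c = 1 / 2 * ∑ d, Gi a d * (dG b d c + dG c d b - dG d b c))
    (hunit : ∑ b, U b * u b = -1)
    (hdunit : ∀ a, ∑ b, (dU a b * u b + U b * du a b) = 0)
    (hcons : ∀ b, ∑ a, ((dw a * U a + w * dU a a) * u b + w * U a * du a b
        + dP a * (if a = b then 1 else 0))
      + ∑ a, ∑ c, Γ a a c * (w * U c * u b + P * (if c = b then 1 else 0))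
      - ∑ a, ∑ c, Γ c a b * (w * U a * u c + P * (if a = c then 1 else 0)) = 0) :
    ∑ a, U a * (dw a - dP a) + w * (∑ a, dU a a + ∑ a, ∑ c, Γ a a c * U c) = 0 := by
  -- Lowering the upper index of `Γ` cancels the inverse metric.
  have lower : ∀ a b, ∑ c, Γ c a b * u c =
      1 / 2 * ∑ d, U d * (dG a d b + dG b d a - dG d a b) := by
    intro a b
    calc ∑ c, Γ c a b * u c
        = ∑ c, ∑ d, ∑ e, 1 / 2 * (G e c * Gi c d) * (U e * (dG a d b + dG b d a - dG d a b)) := by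
          refine Finset.sum_congr rfl fun c _ => ?_
          rw [hΓ, hu, mul_assoc, Finset.sum_mul, Finset.mul_sum]
          refine Finset.sum_congr rfl fun d _ => ?_
          rw [Finset.mul_sum, Finset.mul_sum]
          exact Finset.sum_congr rfl fun e _ => by ring
      _ = ∑ d, ∑ e, 1 / 2 * (∑ c, G e c * Gi c d) * (U e * (dG a d b + dG b d a - dG d a b)) := by
          rw [Finset.sum_comm]
          refine Finset.sum_congr rfl fun d _ => ?_
          rw [Finset.sum_comm]
          refine Finset.sum_congr rfl fun e _ => ?_
          rw [Finset.mul_sum, Finset.sum_mul]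
      _ = _ := by
          simp [hGi, Finset.mul_sum]
  -- Contracted with `U U U`, the three derivatives of the metric coincide after relabelling, and `1
  -- + 1 - 1 = 1`.
  have geod : ∑ a, ∑ b, U a * U b * ∑ c, Γ c a b * u c =
      1 / 2 * ∑ a, ∑ b, ∑ d, U a * U b * U d * dG a d b := by
    have h1 : ∑ a, ∑ b, ∑ d, U a * U b * U d * dG b d a =
        ∑ a, ∑ b, ∑ d, U a * U b * U d * dG a d b := by
      rw [Finset.sum_comm]
      exact Finset.sum_congr rfl fun a _ => Finset.sum_congr rfl fun b _ =>
        Finset.sum_congr rfl fun d _ => by ring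
    have h2 : ∑ a, ∑ b, ∑ d, U a * U b * U d * dG d a b =
        ∑ a, ∑ b, ∑ d, U a * U b * U d * dG a d b := by
      simp_rw [Finset.sum_comm (s := (Finset.univ : Finset n)) (t := Finset.univ)
        (f := fun b d => U _ * U b * U d * dG d _ b)]
      rw [Finset.sum_comm]
      refine Finset.sum_congr rfl fun a _ => ?_
      rw [Finset.sum_comm]
      exact Finset.sum_congr rfl fun b _ => Finset.sum_congr rfl fun d _ => by ring
    have h3 : ∑ a, ∑ b, U a * U b * ∑ c, Γ c a b * u c =
        1 / 2 * (∑ a, ∑ b, ∑ d, U a * U b * U d * dG a d b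
          + ∑ a, ∑ b, ∑ d, U a * U b * U d * dG b d a
          - ∑ a, ∑ b, ∑ d, U a * U b * U d * dG d a b) := by
      simp only [lower, ← Finset.sum_add_distrib, ← Finset.sum_sub_distrib, Finset.mul_sum]
      exact Finset.sum_congr rfl fun a _ => Finset.sum_congr rfl fun b _ =>
        Finset.sum_congr rfl fun d _ => by ring
    rw [h3, h1, h2]
    ring
  have acc : ∀ a, ∑ b, U b * du a b = 1 / 2 * ∑ b, ∑ d, U b * U d * dG a d b := by
    intro a
    have h1 : ∑ b, U b * du a b = ∑ b, ∑ d, U b * U d * dG a d b + ∑ c, dU a c * u c := by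
      have h2 : ∑ c, dU a c * u c = ∑ b, ∑ c, U b * (G c b * dU a c) := by
        rw [Finset.sum_comm]
        refine Finset.sum_congr rfl fun c _ => ?_
        rw [hu, Finset.mul_sum]
        exact Finset.sum_congr rfl fun b _ => by rw [hG b c]; ring
      rw [h2, ← Finset.sum_add_distrib]
      refine Finset.sum_congr rfl fun b _ => ?_
      rw [hdu, Finset.mul_sum, ← Finset.sum_add_distrib]
      exact Finset.sum_congr rfl fun c _ => by ring
    have h3 := hdunit a
    rw [Finset.sum_add_distrib] at h3
    linarith
  -- The acceleration of a unit field is orthogonal to it: `U^a U^b ∇_a u_b = 0`.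
  have cancel : ∑ a, ∑ b, U a * (U b * du a b) = ∑ a, ∑ b, U a * U b * ∑ c, Γ c a b * u c := by
    rw [geod, Finset.mul_sum]
    refine Finset.sum_congr rfl fun a _ => ?_
    rw [← Finset.mul_sum, acc]
    simp only [Finset.mul_sum]
    exact Finset.sum_congr rfl fun b _ => Finset.sum_congr rfl fun c _ => by ring
  have hb : ∀ b, U b * (∑ a, (dw a * U a + w * dU a a)) * u b + w * (∑ a, U a * (U b * du a b))
      + U b * dP b + (∑ a, ∑ c, Γ a a c * (w * U c)) * (U b * u b)
      + U b * P * (∑ a, Γ a a b)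
      - w * (∑ a, U a * U b * ∑ c, Γ c a b * u c) - U b * P * (∑ a, Γ a a b) = 0 := by
    intro b
    have h0 := congrArg (fun z => U b * z) (hcons b)
    simp only [mul_zero] at h0
    rw [← h0]
    simp only [mul_add, mul_sub, Finset.sum_add_distrib, Finset.mul_sum, Finset.sum_mul, mul_ite,
      mul_one, mul_zero, Finset.sum_ite_eq, Finset.sum_ite_eq', Finset.mem_univ, if_true, add_mul]
    have e1 : ∀ a c, w * (U a * U b * (Γ c a b * u c)) = U b * (Γ c a b * (w * U a * u c)) :=
      fun a c => by ring
    have e2 : ∀ a c, Γ a a c * (w * U c) * (U b * u b) = U b * (Γ a a c * (w * U c * u b)) :=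
      fun a c => by ring
    have e3 : ∀ a, w * (U a * (U b * du a b)) = U b * (w * U a * du a b) := fun a => by ring
    have e4 : ∀ a, U b * (dw a * U a) * u b = U b * (dw a * U a * u b) := fun a => by ring
    have e5 : ∀ a, U b * (w * dU a a) * u b = U b * (w * dU a a * u b) := fun a => by ring
    have e6 : ∀ a, U b * P * Γ a a b = U b * (Γ a a b * P) := fun a => by ring
    simp only [e1, e2, e3, e4, e5, e6]
    ring
  have hsum := Finset.sum_congr rfl fun b (_ : b ∈ (Finset.univ : Finset n)) => hb b
  simp only [Finset.sum_add_distrib, Finset.sum_sub_distrib, Finset.sum_const_zero] at hsum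
  have t1 : ∑ b, U b * (∑ a, dw a * U a + ∑ a, w * dU a a) * u b
      = -(∑ a, dw a * U a + ∑ a, w * dU a a) := by
    rw [← neg_one_mul, ← hunit, Finset.sum_mul]
    exact Finset.sum_congr rfl fun b _ => by ring
  have t2 : ∑ b, w * ∑ a, U a * (U b * du a b) = w * ∑ a, ∑ b, U a * U b * ∑ c, Γ c a b * u c := by
    rw [← Finset.mul_sum, Finset.sum_comm, cancel]
  have t3 : ∑ b, w * (∑ a, U a * U b * ∑ c, Γ c a b * u c) =
      w * ∑ a, ∑ b, U a * U b * ∑ c, Γ c a b * u c := by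
    rw [← Finset.mul_sum, Finset.sum_comm]
  have t4 : ∑ b, (∑ a, ∑ c, Γ a a c * (w * U c)) * (U b * u b) =
      -(w * ∑ a, ∑ c, Γ a a c * U c) := by
    rw [← Finset.mul_sum, hunit, mul_neg_one, Finset.mul_sum]
    simp only [Finset.mul_sum]
    exact congrArg Neg.neg (Finset.sum_congr rfl fun a _ => Finset.sum_congr rfl fun b _ => by ring)
  rw [t1, t2, t3, t4, ← Finset.mul_sum] at hsum
  have t5 : ∑ a, U a * (dw a - dP a) = ∑ a, dw a * U a - ∑ a, U a * dP a := by
    rw [← Finset.sum_sub_distrib]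
    exact Finset.sum_congr rfl fun b _ => by ring
  rw [t5, mul_add]
  linarith

theorem pd_mul {a : Fin 4} {f h : E4 → ℝ} {y : E4} (hf : DifferentiableAt ℝ f y)
    (hh : DifferentiableAt ℝ h y) :
    pd a (fun z => f z * h z) y = pd a f y * h y + f y * pd a h y := by
  simp only [pd, fderiv_fun_mul hf hh, add_apply, smul_apply, smul_eq_mul]
  ring

theorem pd_add {a : Fin 4} {f h : E4 → ℝ} {y : E4} (hf : DifferentiableAt ℝ f y)
    (hh : DifferentiableAt ℝ h y) :
    pd a (fun z => f z + h z) y = pd a f y + pd a h y := by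
  simp only [pd, fderiv_fun_add hf hh, add_apply]

theorem pd_sum {a : Fin 4} {ι : Type*} {s : Finset ι} {f : ι → E4 → ℝ} {y : E4}
    (hf : ∀ i ∈ s, DifferentiableAt ℝ (f i) y) :
    pd a (fun z => ∑ i ∈ s, f i z) y = ∑ i ∈ s, pd a (f i) y := by
  simp only [pd, fderiv_fun_sum hf, sum_apply]

theorem pd_congr {a : Fin 4} {f h : E4 → ℝ} {y : E4} (hfh : f =ᶠ[𝓝 y] h) :
    pd a f y = pd a h y := by
  simp only [pd, hfh.fderiv_eq]

theorem pd_const {a : Fin 4} {c : ℝ} {y : E4} : pd a (fun _ => c) y = 0 := by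
  simp [pd]

theorem lower_index (g : LorentzMetric M) {x : M} {y : E4}
    (hy : y ∈ (extChartAt (𝓡 4) x).target) (v : (x : M) → TangentSpace (𝓡 4) x) (b : Fin 4) :
    g.val (pt x y) (v (pt x y)) (coordVec x b y) =
      ∑ c, metricComp g x y c b * vecComp x v c y := by
  rw [eq_sum_vecComp hy v]
  simp only [map_sum, map_smul, sum_apply, smul_apply, smul_eq_mul, metricComp, Matrix.of_apply]
  exact Finset.sum_congr rfl fun c _ => mul_comm _ _

theorem metric_self (g : LorentzMetric M) {x : M} {y : E4}
    (hy : y ∈ (extChartAt (𝓡 4) x).target) (v : (x : M) → TangentSpace (𝓡 4) x) :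
    g.val (pt x y) (v (pt x y)) (v (pt x y)) =
      ∑ b, vecComp x v b y * ∑ c, metricComp g x y c b * vecComp x v c y := by
  simp only [← lower_index g hy]
  have h := congrArg (g.val (pt x y) (v (pt x y))) (eq_sum_vecComp hy v)
  simpa only [map_sum, map_smul, smul_eq_mul] using h

/-- The energy equation: the projection of `∇ · T = 0` on the velocity. -/
theorem PerfectEnergyTensor.energy_equation {g : LorentzMetric M} (T : PerfectEnergyTensor M g)
    (x : M) : dot T.u T.ρ x + (T.ρ x + T.p x) * expansion g T.u x = 0 := by
  set y := extChartAt (𝓡 4) x x with hy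
  have hyt : y ∈ (extChartAt (𝓡 4) x).target := mem_extChartAt_target x
  have hρ := differentiableAt_scalar T.smooth_ρ x
  have hp := differentiableAt_scalar T.smooth_p x
  have hU := differentiableAt_vecComp T.smooth_u x
  have hg := differentiableAt_metricComp g x
  rw [← hy] at hρ hp hU hg
  have hlow : ∀ b, DifferentiableAt ℝ
      (fun z => ∑ c, metricComp g x z c b * vecComp x T.u c z) y := fun b =>
    DifferentiableAt.fun_sum fun c _ => (hg c b).fun_mul (hU c)
  have hdlow : ∀ a b, pd a (fun z => ∑ c, metricComp g x z c b * vecComp x T.u c z) y =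
      ∑ c, (pd a (fun z => metricComp g x z c b) y * vecComp x T.u c y
        + metricComp g x y c b * pd a (vecComp x T.u c) y) := by
    intro a b
    rw [pd_sum fun c _ => (hg c b).fun_mul (hU c)]
    exact Finset.sum_congr rfl fun c _ => pd_mul (hg c b) (hU c)
  -- The normalization holds on a whole neighbourhood, so it can be differentiated.
  have hself : (fun z => ∑ b, vecComp x T.u b z * ∑ c, metricComp g x z c b * vecComp x T.u c z)
      =ᶠ[𝓝 y] fun _ => (-1 : ℝ) := by
    filter_upwards [eventually_mem_target x] with z hz
    rw [← metric_self g hz, T.unit]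
  have hener : ∀ a b, energyComp g T.u T.ρ T.p x a b =ᶠ[𝓝 y] fun z =>
      (T.ρ (pt x z) + T.p (pt x z)) * vecComp x T.u a z *
        (∑ c, metricComp g x z c b * vecComp x T.u c z)
        + T.p (pt x z) * (if a = b then 1 else 0) := by
    intro a b
    filter_upwards [eventually_mem_target x] with z hz
    rw [energyComp, lower_index g hz]
  have key := contracted_divergence (n := Fin 4)
    (U := fun a => vecComp x T.u a y)
    (dw := fun a => pd a (fun z => T.ρ (pt x z) + T.p (pt x z)) y)
    (dP := fun a => pd a (fun z => T.p (pt x z)) y)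
    (u := fun b => ∑ c, metricComp g x y c b * vecComp x T.u c y)
    (dU := fun a b => pd a (vecComp x T.u b) y)
    (du := fun a b => pd a (fun z => ∑ c, metricComp g x z c b * vecComp x T.u c z) y)
    (G := metricComp g x y) (Gi := fun a b => (metricComp g x y)⁻¹ a b)
    (dG := fun a b c => pd a (fun z => metricComp g x z b c) y)
    (Γ := fun a b c => christoffel g x a b c y)
    (w := T.ρ (pt x y) + T.p (pt x y)) (P := T.p (pt x y))
    (metricComp_symm g x y)
    (fun e d => by
      have h := congrFun (congrFun
        (Matrix.mul_nonsing_inv _ (isUnit_det_metricComp g hyt)) e) d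
      rwa [Matrix.mul_apply, Matrix.one_apply] at h)
    (fun b => rfl) (fun a b => hdlow a b) (fun a b c => rfl)
    (by rw [← metric_self g hyt, T.unit])
    (fun a => by
      rw [← pd_const (a := a) (c := (-1 : ℝ)) (y := y), ← pd_congr hself,
        pd_sum fun b _ => (hU b).fun_mul (hlow b)]
      exact Finset.sum_congr rfl fun b _ => (pd_mul (hU b) (hlow b)).symm)
    (fun b => by
      have h := T.conservation x b
      rw [divEnergy, ← hy] at h
      simp only [(hener _ _).eq_of_nhds, pd_congr (hener _ _)] at h
      refine Eq.trans ?_ h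
      congr 2
      refine Finset.sum_congr rfl fun a _ => ?_
      rw [pd_add (((hρ.fun_add hp).fun_mul (hU a)).fun_mul (hlow b))
          (hp.fun_mul (differentiableAt_const _)),
        pd_mul ((hρ.fun_add hp).fun_mul (hU a)) (hlow b), pd_mul (hρ.fun_add hp) (hU a),
        pd_mul hp (differentiableAt_const _), pd_const, mul_zero, add_zero])
  rw [dot_eq_sum_pd T.smooth_ρ, expansion, ← hy]
  have hx : pt x y = x := pt_extChartAt x
  -- With `w = ρ + p` and `P = p`, the difference `dw - dP` is `dρ`.
  simp only [pd_add hρ hp, add_sub_cancel_right, hx] at key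
  exact key

end Geometry

/-! ### Functions of state along the flow, and openness of the range of `π` -/

section Evolution

open Filter Topology

variable {M : Type*} [TopologicalSpace M] [ChartedSpace E4 M] [IsManifold (𝓡 4) ∞ M]
  {g : LorentzMetric M} (T : PerfectEnergyTensor M g)

theorem fderiv_eq_dRho_add_dP (F : ℝ × ℝ → ℝ) (q v : ℝ × ℝ) :
    fderiv ℝ F q v = dRho F q * v.1 + dP F q * v.2 := by
  have h : v = v.1 • ((1, 0) : ℝ × ℝ) + v.2 • ((0, 1) : ℝ × ℝ) := by ext <;> simp
  conv_lhs => rw [h]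
  rw [map_add, map_smul, map_smul, dRho, dP, smul_eq_mul, smul_eq_mul]
  ring

theorem PerfectEnergyTensor.dot_comp_state (v : (x : M) → TangentSpace (𝓡 4) x) {F : ℝ × ℝ → ℝ}
    {x : M} (hF : DifferentiableAt ℝ F (T.state x)) :
    dot v (fun y => F (T.state y)) x =
      dRho F (T.state x) * dot v T.ρ x + dP F (T.state x) * dot v T.p x := by
  have hρ : HasMFDerivAt (𝓡 4) 𝓘(ℝ, ℝ) T.ρ x (differential T.ρ x) :=
    (T.smooth_ρ.mdifferentiableAt (by simp)).hasMFDerivAt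
  have hp : HasMFDerivAt (𝓡 4) 𝓘(ℝ, ℝ) T.p x (differential T.p x) :=
    (T.smooth_p.mdifferentiableAt (by simp)).hasMFDerivAt
  have hs : HasMFDerivAt (𝓡 4) 𝓘(ℝ, ℝ × ℝ) T.state x
      ((differential T.ρ x).prod (differential T.p x)) :=
    ⟨hρ.1.prodMk hp.1, hρ.2.prodMk hp.2⟩
  have h : HasMFDerivAt (𝓡 4) 𝓘(ℝ, ℝ) (fun y => F (T.state y)) x _ :=
    HasMFDerivAt.comp (I' := 𝓘(ℝ, ℝ × ℝ)) x hF.hasFDerivAt.hasMFDerivAt hs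
  rw [dot, differential, h.mfderiv]
  exact fderiv_eq_dRho_add_dP F (T.state x) (differential T.ρ x (v x), differential T.p x (v x))

theorem PerfectEnergyTensor.smooth_pi : ContMDiff (𝓡 4) 𝓘(ℝ, ℝ) ∞ T.pi :=
  T.smooth_p.div₀ T.smooth_ρ fun x => (T.ρ_pos x).ne'

theorem hasFDerivAt_ratio {q : ℝ × ℝ} (hq : q.1 ≠ 0) :
    HasFDerivAt (fun q : ℝ × ℝ => q.2 / q.1)
      ((1 / q.1) • ContinuousLinearMap.snd ℝ ℝ ℝ -
        (q.2 / q.1 ^ 2) • ContinuousLinearMap.fst ℝ ℝ ℝ) q := by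
  have h := (hasFDerivAt_snd (𝕜 := ℝ) (p := q)).fun_mul
    ((hasDerivAt_inv hq).comp_hasFDerivAt q (hasFDerivAt_fst (𝕜 := ℝ) (p := q)))
  simp only [div_eq_mul_inv]
  refine h.congr_fderiv ?_
  ext <;> simp

/-- `dπ = dp/ρ - (p/ρ²) dρ` is a nontrivial combination of independent covectors. -/
theorem PerfectEnergyTensor.exists_pd_pi_ne_zero (hT : T.NonBarotropic) (x : M) :
    ∃ i, pd i (fun y => T.pi (pt x y)) (extChartAt (𝓡 4) x x) ≠ 0 := by
  by_contra! h
  have hdot : ∀ v : (x : M) → TangentSpace (𝓡 4) x, dot v T.pi x = 0 := fun v => by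
    rw [dot_eq_sum_pd T.smooth_pi]
    exact Finset.sum_eq_zero fun i _ => by rw [h i, mul_zero]
  have hρ := (T.ρ_pos x).ne'
  have hF := hasFDerivAt_ratio (q := T.state x) hρ
  have hrel : (-(T.p x / T.ρ x ^ 2)) • differential T.ρ x +
      (1 / T.ρ x) • differential T.p x = 0 := by
    ext w
    -- Only the value at `x` matters for `dot`, so any extension of `w` serves; all tangent spaces
    -- are `E4` by definition.
    let v : (x : M) → TangentSpace (𝓡 4) x := fun _ => w
    have h1 := T.dot_comp_state v hF.differentiableAt
    rw [dRho, dP, hF.fderiv] at h1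
    have h2 := h1.symm.trans (hdot v)
    simp [PerfectEnergyTensor.state, dot] at h2 ⊢
    linarith
  have := (LinearIndependent.pair_iff.1 (hT x) _ _ hrel).2
  simp [hρ] at this

/-- `π` is a submersion, hence an open map. This makes smoothness, `deriv` and primitives on the
range meaningful. -/
theorem PerfectEnergyTensor.isOpen_range_pi (hT : T.NonBarotropic) :
    IsOpen (Set.range T.pi) := by
  rw [isOpen_iff_mem_nhds]
  rintro _ ⟨x, rfl⟩
  obtain ⟨i, hi⟩ := T.exists_pd_pi_ne_zero hT x
  have hc : ContDiffAt ℝ ∞ (fun y => T.pi (pt x y)) (extChartAt (𝓡 4) x x) :=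
    ContMDiffAt.contDiffAt (T.smooth_pi.contMDiffAt.comp _ (contMDiffAt_pt x))
  have hs := hc.hasStrictFDerivAt (by simp)
  have hsurj : (fderiv ℝ (fun y => T.pi (pt x y)) (extChartAt (𝓡 4) x x)).range = ⊤ := by
    rw [LinearMap.range_eq_top]
    refine LinearMap.surjective fun h0 => hi ?_
    exact congrArg (fun L => L (e4 i)) h0
  have := hs.map_nhds_eq_of_surj hsurj
  rw [pt_extChartAt] at this
  rw [← this]
  exact mem_map.2 (Eventually.of_forall fun y => ⟨_, rfl⟩)

end Evolution

/-! ### The entropy of an ideal gas -/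

section IdealGas

open Filter Topology

theorem two_le_infty : (2 : WithTop ℕ∞) ≤ ∞ := ENat.LEInfty.out

namespace StateFunctions

variable {G : StateFunctions} {k : ℝ}

theorem IsIdealGas.p_pos (hG : G.IsIdealGas k) (hk : 0 < k) {q : ℝ × ℝ} (hq : q ∈ G.domain) :
    0 < q.2 := by
  rw [hG.eos q hq]
  exact mul_pos (mul_pos hk (hG.r_pos q hq)) (hG.Θ_pos q hq)

theorem IsLTE.contDiffAt_r (hG : G.IsLTE) {q : ℝ × ℝ} (hq : q ∈ G.domain) :
    ContDiffAt ℝ ∞ G.r q := hG.smooth_r.contDiffAt (hG.isOpen_domain.mem_nhds hq)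

theorem IsLTE.contDiffAt_s (hG : G.IsLTE) {q : ℝ × ℝ} (hq : q ∈ G.domain) :
    ContDiffAt ℝ ∞ G.s q := hG.smooth_s.contDiffAt (hG.isOpen_domain.mem_nhds hq)

theorem IsLTE.contDiffAt_log_r (hG : G.IsLTE) {q : ℝ × ℝ} (hq : q ∈ G.domain) :
    ContDiffAt ℝ ∞ (fun q => Real.log (G.r q)) q :=
  (hG.contDiffAt_r hq).log (hG.r_pos q hq).ne'

theorem fderiv_energy_add_vol {q : ℝ × ℝ} (hr : G.r q ≠ 0) (hd : DifferentiableAt ℝ G.r q) :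
    fderiv ℝ G.energy q + q.2 • fderiv ℝ G.vol q =
      (G.r q)⁻¹ • ContinuousLinearMap.fst ℝ ℝ ℝ -
        ((q.1 + q.2) * (G.r q ^ 2)⁻¹) • fderiv ℝ G.r q := by
  have hinv : HasFDerivAt (fun q => (G.r q)⁻¹) ((-(G.r q ^ 2)⁻¹) • fderiv ℝ G.r q) q :=
    (hasDerivAt_inv hr).comp_hasFDerivAt q hd.hasFDerivAt
  have hvol : fderiv ℝ G.vol q = (-(G.r q ^ 2)⁻¹) • fderiv ℝ G.r q := by
    refine HasFDerivAt.fderiv ?_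
    exact hinv.congr_of_eventuallyEq (Eventually.of_forall fun z => by simp [vol])
  have hen : fderiv ℝ G.energy q = q.1 • (-(G.r q ^ 2)⁻¹) • fderiv ℝ G.r q
      + (G.r q)⁻¹ • ContinuousLinearMap.fst ℝ ℝ ℝ := by
    refine HasFDerivAt.fderiv ?_
    have h := ((hasFDerivAt_fst (𝕜 := ℝ) (p := q)).fun_mul hinv).sub_const 1
    exact h.congr_of_eventuallyEq (Eventually.of_forall fun z => by simp [energy, div_eq_mul_inv])
  rw [hen, hvol]
  ext <;> simp <;> ring

/-- The energy balance of an ideal gas in terms of `log r`: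
`(p / k) ds + (ρ + p) d(log r) = dρ`. -/
theorem IsIdealGas.balance_log (hG : G.IsIdealGas k) (hk : 0 < k) {q : ℝ × ℝ}
    (hq : q ∈ G.domain) :
    (q.2 / k) • fderiv ℝ G.s q + (q.1 + q.2) • fderiv ℝ (fun q => Real.log (G.r q)) q =
      ContinuousLinearMap.fst ℝ ℝ ℝ := by
  have hr := (hG.r_pos q hq).ne'
  have hd := (hG.contDiffAt_r hq).differentiableAt (by simp)
  have he : q.2 / k = G.r q * G.Θ q := by
    rw [hG.eos q hq]; field_simp
  rw [(hd.hasFDerivAt.log hr).fderiv, he, mul_smul, hG.balance q hq, fderiv_energy_add_vol hr hd]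
  ext <;> simp <;> field_simp <;> ring

/-- This is the integrability condition of `balance_log`: the mixed second derivatives of `s` and
`log r` are symmetric. -/
theorem IsIdealGas.euler (hG : G.IsIdealGas k) (hk : 0 < k) {q : ℝ × ℝ}
    (hq : q ∈ G.domain) : q.1 * dRho G.s q + q.2 * dP G.s q = -k := by
  set ℓ : ℝ × ℝ → ℝ := fun q => Real.log (G.r q)
  have hs := hG.contDiffAt_s hq
  have hl : ContDiffAt ℝ ∞ ℓ q := hG.contDiffAt_log_r hq
  have hs2 : IsSymmSndFDerivAt ℝ G.s q := hs.isSymmSndFDerivAt (by simpa using two_le_infty)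
  have hl2 : IsSymmSndFDerivAt ℝ ℓ q := hl.isSymmSndFDerivAt (by simpa using two_le_infty)
  have hds : HasFDerivAt (fderiv ℝ G.s) (fderiv ℝ (fderiv ℝ G.s) q) q :=
    ((hs.fderiv_right (m := 1) (by simpa [one_add_one_eq_two] using two_le_infty)).differentiableAt
      (by simp)).hasFDerivAt
  have hdl : HasFDerivAt (fderiv ℝ ℓ) (fderiv ℝ (fderiv ℝ ℓ) q) q :=
    ((hl.fderiv_right (m := 1) (by simpa [one_add_one_eq_two] using two_le_infty)).differentiableAt
      (by simp)).hasFDerivAt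
  have hp : HasFDerivAt (fun q : ℝ × ℝ => q.2 / k) (k⁻¹ • ContinuousLinearMap.snd ℝ ℝ ℝ) q := by
    simpa only [div_eq_mul_inv] using (hasFDerivAt_snd (𝕜 := ℝ) (p := q)).mul_const k⁻¹
  have hρp := (hasFDerivAt_fst (𝕜 := ℝ) (p := q)).fun_add (hasFDerivAt_snd (𝕜 := ℝ) (p := q))
  have hd := (hp.fun_smul hds).fun_add (hρp.fun_smul hdl)
  have hconst : (fun q : ℝ × ℝ => (q.2 / k) • fderiv ℝ G.s q + (q.1 + q.2) • fderiv ℝ ℓ q)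
      =ᶠ[𝓝 q] fun _ => ContinuousLinearMap.fst ℝ ℝ ℝ := by
    filter_upwards [hG.isOpen_domain.mem_nhds hq] with z hz using hG.balance_log hk hz
  have h0 := hd.fderiv.symm.trans (hconst.fderiv_eq.trans (fderiv_const_apply _))
  have h1 := congrArg (fun L : ℝ × ℝ →L[ℝ] ℝ × ℝ →L[ℝ] ℝ => L (0, 1) (1, 0)) h0
  have h2 := congrArg (fun L : ℝ × ℝ →L[ℝ] ℝ × ℝ →L[ℝ] ℝ => L (1, 0) (0, 1)) h0
  have h3 := congrArg (fun L : ℝ × ℝ →L[ℝ] ℝ => L (1, 0)) (hG.balance_log hk hq)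
  have h4 := congrArg (fun L : ℝ × ℝ →L[ℝ] ℝ => L (0, 1)) (hG.balance_log hk hq)
  have e1 := hs2 (0, 1) (1, 0)
  have e2 := hl2 (0, 1) (1, 0)
  simp [e1, e2] at h1 h2 h3 h4
  -- The difference of the two mixed evaluations: all second-order terms cancel. Multiplying by `ρ +
  -- p` then lets the balance eliminate `log r`.
  have h5 : k⁻¹ * dRho G.s q + fderiv ℝ ℓ q (1, 0) = fderiv ℝ ℓ q (0, 1) := by
    rw [dRho]; linarith
  have h6 : (q.1 + q.2) * (k⁻¹ * dRho G.s q) = - 1 + q.2 / k * dRho G.s q - q.2 / k * dP G.s q := by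
    have := congrArg (fun z => (q.1 + q.2) * z) h5
    simp only [mul_add, dRho, dP] at this ⊢
    linarith
  field_simp at h6
  linarith

theorem IsLTE.eventually_ray_mem (hG : G.IsLTE) {q : ℝ × ℝ} (hq : q ∈ G.domain) :
    ∀ᶠ t in 𝓝 (q.2 / q.1), (q.1, t * q.1) ∈ G.domain := by
  have hc : ContinuousAt (fun t : ℝ => (q.1, t * q.1)) (q.2 / q.1) := by fun_prop
  refine hc.eventually_mem (hG.isOpen_domain.mem_nhds ?_)
  rw [div_mul_cancel₀ _ (hG.ρ_pos q hq).ne']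
  exact hq

/-- The values of `p / ρ` on the domain. -/
def ratios (G : StateFunctions) : Set ℝ := (fun q : ℝ × ℝ => q.2 / q.1) '' G.domain

theorem IsLTE.isOpen_ratios (hG : G.IsLTE) : IsOpen G.ratios := by
  rw [isOpen_iff_mem_nhds]
  rintro _ ⟨q, hq, rfl⟩
  filter_upwards [hG.eventually_ray_mem hq] with t ht
  exact ⟨_, ht, by simp [(hG.ρ_pos q hq).ne']⟩

theorem IsIdealGas.ratios_pos (hG : G.IsIdealGas k) (hk : 0 < k) {t : ℝ} (ht : t ∈ G.ratios) :
    0 < t := by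
  obtain ⟨q, hq, rfl⟩ := ht
  exact div_pos (hG.p_pos hk hq) (hG.ρ_pos q hq)

/-- By `euler`, the derivative of `s + k log ρ` along the ray `p = cρ` vanishes. Connectedness of
the ray within the domain turns this into constancy. -/
theorem IsIdealGas.const_on_rays (hG : G.IsIdealGas k) (hk : 0 < k) {q q' : ℝ × ℝ}
    (hq : q ∈ G.domain) (hq' : q' ∈ G.domain) (h : q.2 / q.1 = q'.2 / q'.1) :
    G.s q + k * Real.log q.1 = G.s q' + k * Real.log q'.1 := by
  set c := q.2 / q.1 with hc
  let I : Set ℝ := {a | (a, c * a) ∈ G.domain}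
  have hI : IsOpen I := hG.isOpen_domain.preimage (by fun_prop)
  have hImage : I = Prod.fst '' {q : ℝ × ℝ | q ∈ G.domain ∧ q.2 = c * q.1} := by
    ext a
    constructor
    · exact fun ha => ⟨(a, c * a), ⟨ha, rfl⟩, rfl⟩
    · rintro ⟨⟨b, d⟩, ⟨hz, hz2⟩, rfl⟩
      simp only at hz2
      simpa [I, hz2] using hz
  have hpre : IsPreconnected I := by
    rw [hImage]
    exact (hG.rays_connected c).image _ continuous_fst.continuousOn
  have hder : ∀ a ∈ I, HasDerivAt (fun a => G.s (a, c * a) + k * Real.log a) 0 a := by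
    intro a ha
    have hapos := hG.ρ_pos _ ha
    simp only at hapos
    have hs : HasFDerivAt G.s (fderiv ℝ G.s (a, c * a)) (a, c * a) :=
      ((hG.contDiffAt_s ha).differentiableAt (by simp)).hasFDerivAt
    have hline : HasDerivAt (fun a : ℝ => (a, c * a)) (1, c * 1) a :=
      (hasDerivAt_id a).prodMk ((hasDerivAt_id a).const_mul c)
    have h1 := hs.comp_hasDerivAt a hline
    have h2 := (Real.hasDerivAt_log hapos.ne').const_mul k
    refine (h1.add h2).congr_deriv ?_
    have he := hG.euler hk ha
    rw [fderiv_eq_dRho_add_dP]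
    simp only at he ⊢
    field_simp
    linarith
  have key : ∀ {z : ℝ × ℝ}, z ∈ G.domain → z.2 / z.1 = c → z.1 ∈ I ∧ (z.1, c * z.1) = z := by
    intro z hz hzc
    have hz2 : (z.1, c * z.1) = z := by
      ext
      · rfl
      · simp only [← hzc]
        exact div_mul_cancel₀ _ (hG.ρ_pos z hz).ne'
    exact ⟨by simpa only [I, Set.mem_ofPred_eq, hz2] using hz, hz2⟩
  have h1 := key hq rfl
  have h2 := key hq' h.symm
  have := hI.is_const_of_deriv_eq_zero hpre
    (fun a ha => (hder a ha).differentiableAt.differentiableWithinAt)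
    (fun a ha => (hder a ha).deriv) h1.1 h2.1
  simpa only [h1.2, h2.2] using this

/-- The specific entropy of an ideal gas is `φ(p / ρ) - k log ρ`. -/
theorem IsIdealGas.exists_entropy_profile (hG : G.IsIdealGas k) (hk : 0 < k) :
    ∃ φ : ℝ → ℝ, (∀ t ∈ G.ratios, ContDiffAt ℝ ∞ φ t) ∧
      ∀ q ∈ G.domain, G.s q = φ (q.2 / q.1) - k * Real.log q.1 := by
  classical
  -- `f` picks an arbitrary, possibly discontinuous, state on each ray; the value of `s + k log ρ`
  -- does not depend on the choice.
  choose! f hf hft using fun (t : ℝ) (ht : t ∈ G.ratios) => ht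
  have hφ : ∀ q ∈ G.domain, G.s (f (q.2 / q.1)) + k * Real.log (f (q.2 / q.1)).1 =
      G.s q + k * Real.log q.1 := fun q hq =>
    hG.const_on_rays hk (hf _ ⟨q, hq, rfl⟩) hq (hft _ ⟨q, hq, rfl⟩)
  refine ⟨fun t => G.s (f t) + k * Real.log (f t).1, ?_, fun q hq => ?_⟩
  · rintro _ ⟨q, hq, rfl⟩
    have hρ := (hG.ρ_pos q hq).ne'
    -- Near this ratio the choice can be replaced by the smooth one with `ρ` fixed.
    have h1 : ContDiffAt ℝ ∞ (fun t : ℝ => G.s (q.1, t * q.1) + k * Real.log q.1) (q.2 / q.1) := by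
      refine ContDiffAt.add (ContDiffAt.comp _ (hG.contDiffAt_s ?_) ?_) contDiffAt_const
      · rw [div_mul_cancel₀ _ hρ]
        exact hq
      · fun_prop
    refine h1.congr_of_eventuallyEq ?_
    filter_upwards [hG.eventually_ray_mem hq] with t ht
    have := hφ _ ht
    simpa only [mul_div_cancel_right₀ _ hρ] using this
  · simp only [hφ q hq]
    ring

end StateFunctions

end IdealGas

/-! ### Compressibility conditions in terms of the entropy profile -/

section Compressibility

open Filter Topology

theorem hasFDerivAt_comp_ratio {f : ℝ → ℝ} {f' : ℝ} {q : ℝ × ℝ} (hq : q.1 ≠ 0)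
    (hf : HasDerivAt f f' (q.2 / q.1)) :
    HasFDerivAt (fun q : ℝ × ℝ => f (q.2 / q.1))
      (f' • ((1 / q.1) • ContinuousLinearMap.snd ℝ ℝ ℝ -
        (q.2 / q.1 ^ 2) • ContinuousLinearMap.fst ℝ ℝ ℝ)) q :=
  hf.comp_hasFDerivAt q (hasFDerivAt_ratio hq)

theorem clm_prod_eq_smul {A : ℝ × ℝ →L[ℝ] ℝ} :
    A = A (1, 0) • ContinuousLinearMap.fst ℝ ℝ ℝ + A (0, 1) • ContinuousLinearMap.snd ℝ ℝ ℝ := by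
  ext <;> simp

/-- The function `(p'_ρ)_s⁻¹ = 1 / χ` of `π` for the entropy profile `φ`. -/
noncomputable def invSqSound (k : ℝ) (φ : ℝ → ℝ) (t : ℝ) : ℝ := deriv φ t / (k + t * deriv φ t)

namespace StateFunctions

variable {G : StateFunctions} {k : ℝ} {φ : ℝ → ℝ}

theorem IsIdealGas.fderiv_s (hG : G.IsIdealGas k)
    (hφ : ∀ t ∈ G.ratios, ContDiffAt ℝ ∞ φ t)
    (hs : ∀ q ∈ G.domain, G.s q = φ (q.2 / q.1) - k * Real.log q.1) {q : ℝ × ℝ}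
    (hq : q ∈ G.domain) :
    fderiv ℝ G.s q =
      (-(k + q.2 / q.1 * deriv φ (q.2 / q.1)) / q.1) • ContinuousLinearMap.fst ℝ ℝ ℝ
        + (deriv φ (q.2 / q.1) / q.1) • ContinuousLinearMap.snd ℝ ℝ ℝ := by
  have hρ := (hG.ρ_pos q hq).ne'
  have h1 := hasFDerivAt_comp_ratio hρ
    ((hφ _ ⟨q, hq, rfl⟩).differentiableAt (by simp)).hasDerivAt
  have h2 := ((hasFDerivAt_fst (𝕜 := ℝ) (p := q)).log hρ).const_mul k
  have h3 : G.s =ᶠ[𝓝 q] fun q => φ (q.2 / q.1) - k * Real.log q.1 := by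
    filter_upwards [hG.isOpen_domain.mem_nhds hq] with z hz using hs z hz
  rw [((h1.fun_sub h2).congr_of_eventuallyEq h3).fderiv]
  ext <;> simp <;> field_simp
  ring

theorem IsIdealGas.dRho_s (hG : G.IsIdealGas k)
    (hφ : ∀ t ∈ G.ratios, ContDiffAt ℝ ∞ φ t)
    (hs : ∀ q ∈ G.domain, G.s q = φ (q.2 / q.1) - k * Real.log q.1) {q : ℝ × ℝ}
    (hq : q ∈ G.domain) :
    dRho G.s q = -(k + q.2 / q.1 * deriv φ (q.2 / q.1)) / q.1 := by
  rw [dRho, hG.fderiv_s hφ hs hq]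
  simp

theorem IsIdealGas.dP_s (hG : G.IsIdealGas k)
    (hφ : ∀ t ∈ G.ratios, ContDiffAt ℝ ∞ φ t)
    (hs : ∀ q ∈ G.domain, G.s q = φ (q.2 / q.1) - k * Real.log q.1) {q : ℝ × ℝ}
    (hq : q ∈ G.domain) :
    dP G.s q = deriv φ (q.2 / q.1) / q.1 := by
  rw [dP, hG.fderiv_s hφ hs hq]
  simp

theorem coords_iff : G.EntropyPressureCoords ↔ ∀ q ∈ G.domain, dRho G.s q ≠ 0 := by
  refine forall₂_congr fun q _ => ?_
  rw [LinearIndependent.pair_iff]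
  constructor
  · intro h h0
    have := (h 1 (-dP G.s q) (by
      rw [clm_prod_eq_smul (A := fderiv ℝ G.s q)]
      ext
      · simpa [dRho] using h0
      · simp [dP])).1
    exact one_ne_zero this
  · intro h a b hab
    have h1 := congrArg (fun L : ℝ × ℝ →L[ℝ] ℝ => L (1, 0)) hab
    have h2 := congrArg (fun L : ℝ × ℝ →L[ℝ] ℝ => L (0, 1)) hab
    rw [dRho] at h
    simp [h] at h1 h2
    simpa [h1] using h2

/-- Identifies the partial derivatives that `SatisfiesH1H2` only asserts to exist with the computed
ones. -/
theorem partials_unique {q : ℝ × ℝ} (hq : dRho G.s q ≠ 0) {a b a' b' : ℝ}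
    (h : a • fderiv ℝ G.s q + b • ContinuousLinearMap.snd ℝ ℝ ℝ =
      a' • fderiv ℝ G.s q + b' • ContinuousLinearMap.snd ℝ ℝ ℝ) : a = a' ∧ b = b' := by
  have h1 := congrArg (fun L : ℝ × ℝ →L[ℝ] ℝ => L (1, 0)) h
  have h2 := congrArg (fun L : ℝ × ℝ →L[ℝ] ℝ => L (0, 1)) h
  rw [dRho] at hq
  simp [hq] at h1 h2
  simpa [h1] using h2

theorem IsIdealGas.hasFDerivAt_exp (hG : G.IsIdealGas k) (hk : 0 < k) {q : ℝ × ℝ}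
    (hq : q ∈ G.domain) :
    HasFDerivAt (fun q => Real.exp (-2 * Real.log (G.r q)))
      ((Real.exp (-2 * Real.log (G.r q)) * (-2 / (q.1 + q.2))) •
        (ContinuousLinearMap.fst ℝ ℝ ℝ - (q.2 / k) • fderiv ℝ G.s q)) q := by
  have hsum : q.1 + q.2 ≠ 0 := (add_pos (hG.ρ_pos q hq) (hG.p_pos hk hq)).ne'
  have hL : HasFDerivAt (fun q => Real.log (G.r q)) (fderiv ℝ (fun q => Real.log (G.r q)) q) q :=
    ((hG.contDiffAt_log_r hq).differentiableAt (by simp)).hasFDerivAt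
  refine (hL.const_mul (-2)).exp.congr_fderiv ?_
  rw [← hG.balance_log hk hq, add_sub_cancel_left, smul_smul, smul_smul]
  congr 1
  field_simp

theorem IsIdealGas.dynVol_eq (hG : G.IsIdealGas k) {q : ℝ × ℝ} (hq : q ∈ G.domain) :
    G.dynVol q = (q.1 + q.2) * Real.exp (-2 * Real.log (G.r q)) := by
  have hr := hG.r_pos q hq
  rw [show -2 * Real.log (G.r q) = -(Real.log (G.r q) + Real.log (G.r q)) by ring, Real.exp_neg,
    Real.exp_add, Real.exp_log hr, dynVol, enthalpy, energy, vol]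
  field_simp
  ring

/-- By `balance_log`, `r² dτ = dp - dρ + (2p/k) ds`; it remains to express `dρ` through `ds` and
`dp`. -/
theorem IsIdealGas.hasFDerivAt_dynVol (hG : G.IsIdealGas k) (hk : 0 < k)
    (hφ : ∀ t ∈ G.ratios, ContDiffAt ℝ ∞ φ t)
    (hs : ∀ q ∈ G.domain, G.s q = φ (q.2 / q.1) - k * Real.log q.1) {q : ℝ × ℝ}
    (hq : q ∈ G.domain) (hne : k + q.2 / q.1 * deriv φ (q.2 / q.1) ≠ 0) :
    HasFDerivAt G.dynVol
      ((Real.exp (-2 * Real.log (G.r q)) * (q.1 * (2 * (q.2 / q.1) / k +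
          1 / (k + q.2 / q.1 * deriv φ (q.2 / q.1))))) • fderiv ℝ G.s q
        + (Real.exp (-2 * Real.log (G.r q)) * (1 - invSqSound k φ (q.2 / q.1))) •
          ContinuousLinearMap.snd ℝ ℝ ℝ) q := by
  have hρ := hG.ρ_pos q hq
  have hp := hG.p_pos hk hq
  have h := ((hasFDerivAt_fst (𝕜 := ℝ) (p := q)).fun_add
    (hasFDerivAt_snd (𝕜 := ℝ) (p := q))).fun_mul (hG.hasFDerivAt_exp hk hq)
  have heq : G.dynVol =ᶠ[𝓝 q] fun q => (q.1 + q.2) * Real.exp (-2 * Real.log (G.r q)) := by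
    filter_upwards [hG.isOpen_domain.mem_nhds hq] with z hz using hG.dynVol_eq hz
  refine (h.congr_of_eventuallyEq heq).congr_fderiv ?_
  rw [hG.fderiv_s hφ hs hq, invSqSound]
  generalize Real.exp (-2 * Real.log (G.r q)) = E
  generalize deriv φ (q.2 / q.1) = a at hne ⊢
  obtain ⟨ρ, p⟩ := q
  simp only at hρ hp hne ⊢
  have hsum : ρ + p ≠ 0 := (add_pos hρ hp).ne'
  generalize hD : k + p / ρ * a = D at hne ⊢
  have ha : a = (D - k) * ρ / p := by rw [← hD]; field_simp; ring
  rw [ha]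
  ext
  · simp
    field_simp
    ring
  · simp
    field_simp
    ring

/-- The `ds` coefficient stays anonymous because H₁ and H₂ do not constrain the mixed derivative of
`τ`. -/
theorem IsIdealGas.hasFDerivAt_dynVol_p (hG : G.IsIdealGas k) (hk : 0 < k)
    (hφ : ∀ t ∈ G.ratios, ContDiffAt ℝ ∞ φ t)
    (hs : ∀ q ∈ G.domain, G.s q = φ (q.2 / q.1) - k * Real.log q.1) {q : ℝ × ℝ}
    (hq : q ∈ G.domain) (hne : k + q.2 / q.1 * deriv φ (q.2 / q.1) ≠ 0) :
    ∃ c : ℝ, HasFDerivAt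
      (fun q => Real.exp (-2 * Real.log (G.r q)) * (1 - invSqSound k φ (q.2 / q.1)))
      (c • fderiv ℝ G.s q
        + (Real.exp (-2 * Real.log (G.r q)) / (q.1 * (1 + q.2 / q.1)) *
            (-deriv (invSqSound k φ) (q.2 / q.1) *
              (1 - q.2 / q.1 * invSqSound k φ (q.2 / q.1)) * (1 + q.2 / q.1)
              - 2 * (1 - invSqSound k φ (q.2 / q.1)) * invSqSound k φ (q.2 / q.1))) •
          ContinuousLinearMap.snd ℝ ℝ ℝ) q := by
  have hρ := hG.ρ_pos q hq
  have hp := hG.p_pos hk hq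
  have hd : DifferentiableAt ℝ (invSqSound k φ) (q.2 / q.1) := by
    have h1 : DifferentiableAt ℝ (deriv φ) (q.2 / q.1) := by
      have h2 := (hφ _ ⟨q, hq, rfl⟩).fderiv_right (m := 1)
        (by simpa [one_add_one_eq_two] using two_le_infty)
      exact (h2.differentiableAt (by simp)).clm_apply (differentiableAt_const 1)
    exact h1.div ((differentiableAt_const k).add (differentiableAt_id.mul h1)) hne
  have h := (hG.hasFDerivAt_exp hk hq).fun_mul
    ((hasFDerivAt_comp_ratio hρ.ne' hd.hasDerivAt).const_sub 1)
  have hψ : invSqSound k φ (q.2 / q.1) * (k + q.2 / q.1 * deriv φ (q.2 / q.1)) =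
      deriv φ (q.2 / q.1) := div_mul_cancel₀ _ hne
  -- Change of basis: `dρ = -(ρ/D) ds + ψ dp`, with `D = k + π φ'` and `ψ = invSqSound k φ π`.
  have key : ∀ A : ℝ × ℝ →L[ℝ] ℝ, A =
      (A (1, 0) * (-q.1 / (k + q.2 / q.1 * deriv φ (q.2 / q.1)))) • fderiv ℝ G.s q
        + (A (0, 1) + invSqSound k φ (q.2 / q.1) * A (1, 0)) •
          ContinuousLinearMap.snd ℝ ℝ ℝ := by
    intro A
    rw [hG.fderiv_s hφ hs hq, show invSqSound k φ (q.2 / q.1) =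
      deriv φ (q.2 / q.1) / (k + q.2 / q.1 * deriv φ (q.2 / q.1)) from rfl]
    generalize k + q.2 / q.1 * deriv φ (q.2 / q.1) = D at hne ⊢
    ext
    · simp
      field_simp
    · simp
      field_simp
      ring
  have h' := h.congr_fderiv (key _)
  refine ⟨_, h'.congr_fderiv (congrArg₂ (· + ·) rfl (congrArg (· • _) ?_))⟩
  rw [hG.fderiv_s hφ hs hq]
  generalize Real.exp (-2 * Real.log (G.r q)) = E
  generalize deriv (invSqSound k φ) (q.2 / q.1) = b
  generalize invSqSound k φ (q.2 / q.1) = ψ at hψ ⊢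
  generalize k + q.2 / q.1 * deriv φ (q.2 / q.1) = D at hψ ⊢
  rw [← hψ]
  obtain ⟨ρ, p⟩ := q
  simp only at hρ hp ⊢
  have hsum : ρ + p ≠ 0 := (add_pos hρ hp).ne'
  simp
  field_simp
  ring

/-- The four conditions are, in order, `ds ∧ dp ≠ 0`, `τ'_p < 0`, `τ'_s > 0` and `τ''_p > 0`,
stripped of positive factors. -/
theorem IsIdealGas.satisfiesH1H2_iff_profile (hG : G.IsIdealGas k) (hk : 0 < k)
    (hφ : ∀ t ∈ G.ratios, ContDiffAt ℝ ∞ φ t)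
    (hs : ∀ q ∈ G.domain, G.s q = φ (q.2 / q.1) - k * Real.log q.1) :
    G.SatisfiesH1H2 ↔ ∀ t ∈ G.ratios, k + t * deriv φ t ≠ 0 ∧ 1 < invSqSound k φ t ∧
      0 < 2 * t / k + 1 / (k + t * deriv φ t) ∧
      0 < -deriv (invSqSound k φ) t * (1 - t * invSqSound k φ t) * (1 + t)
        - 2 * (1 - invSqSound k φ t) * invSqSound k φ t := by
  have hcoord : ∀ q ∈ G.domain, dRho G.s q ≠ 0 ↔
      k + q.2 / q.1 * deriv φ (q.2 / q.1) ≠ 0 := by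
    intro q hq
    rw [hG.dRho_s hφ hs hq, Ne, div_eq_zero_iff, neg_eq_zero, not_or]
    exact and_iff_left (hG.ρ_pos q hq).ne'
  have hfac : ∀ q ∈ G.domain, 0 < Real.exp (-2 * Real.log (G.r q)) / (q.1 * (1 + q.2 / q.1)) :=
    fun q hq => by
      have h1 := hG.ρ_pos q hq
      have h2 := hG.p_pos hk hq
      positivity
  constructor
  · rintro ⟨hc, τs, τp, τps, τpp, h1, h2, h3, h4⟩ _ ⟨q, hq, rfl⟩
    have hs0 := coords_iff.1 hc
    have hρ := hG.ρ_pos q hq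
    have e1 : ∀ z ∈ G.domain, τs z = _ ∧ τp z = _ := fun z hz =>
      partials_unique (hs0 z hz) ((h1 z hz).unique
        (hG.hasFDerivAt_dynVol hk hφ hs hz ((hcoord z hz).1 (hs0 z hz))))
    obtain ⟨c, hc⟩ := hG.hasFDerivAt_dynVol_p hk hφ hs hq ((hcoord q hq).1 (hs0 q hq))
    have heq : τp =ᶠ[𝓝 q] fun q =>
        Real.exp (-2 * Real.log (G.r q)) * (1 - invSqSound k φ (q.2 / q.1)) := by
      filter_upwards [hG.isOpen_domain.mem_nhds hq] with z hz using (e1 z hz).2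
    have e2 := (partials_unique (hs0 q hq)
      ((h2 q hq).unique (hc.congr_of_eventuallyEq heq))).2
    refine ⟨(hcoord q hq).1 (hs0 q hq), ?_, ?_, ?_⟩
    · have := (h3 q hq).1
      rw [(e1 q hq).2] at this
      have h5 := (pos_iff_neg_of_mul_neg this).1 (Real.exp_pos _)
      linarith
    · have := h4 q hq
      rw [(e1 q hq).1] at this
      exact (pos_iff_pos_of_mul_pos ((pos_iff_pos_of_mul_pos this).1 (Real.exp_pos _))).1 hρ
    · have := (h3 q hq).2
      rw [e2] at this
      exact (pos_iff_pos_of_mul_pos this).1 (hfac q hq)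
  · intro h
    have h' : ∀ q ∈ G.domain, _ := fun q hq => h _ ⟨q, hq, rfl⟩
    have hc := fun q hq => hG.hasFDerivAt_dynVol_p hk hφ hs hq (h' q hq).1
    choose! c hc using hc
    refine ⟨coords_iff.2 fun q hq => (hcoord q hq).2 (h' q hq).1, _, _, c, _,
      fun q hq => hG.hasFDerivAt_dynVol hk hφ hs hq (h' q hq).1, hc, fun q hq => ⟨?_, ?_⟩,
      fun q hq => ?_⟩
    · exact mul_neg_of_pos_of_neg (Real.exp_pos _) (by linarith [(h' q hq).2.1])
    · exact mul_pos (hfac q hq) (h' q hq).2.2.2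
    · exact mul_pos (Real.exp_pos _) (mul_pos (hG.ρ_pos q hq) (h' q hq).2.2.1)

theorem IsIdealGas.hasSqSoundSpeed_iff_profile (hG : G.IsIdealGas k)
    (hφ : ∀ t ∈ G.ratios, ContDiffAt ℝ ∞ φ t)
    (hs : ∀ q ∈ G.domain, G.s q = φ (q.2 / q.1) - k * Real.log q.1) (χ : ℝ → ℝ) :
    G.HasSqSoundSpeed (fun q => χ (q.2 / q.1)) ↔
      ∀ t ∈ G.ratios, deriv φ t ≠ 0 ∧ χ t = (k + t * deriv φ t) / deriv φ t := by
  have h : ∀ q ∈ G.domain, (dP G.s q ≠ 0 ∧ χ (q.2 / q.1) = -dRho G.s q / dP G.s q) ↔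
      (deriv φ (q.2 / q.1) ≠ 0 ∧ χ (q.2 / q.1) =
        (k + q.2 / q.1 * deriv φ (q.2 / q.1)) / deriv φ (q.2 / q.1)) := by
    intro q hq
    have hρ := (hG.ρ_pos q hq).ne'
    rw [hG.dRho_s hφ hs hq, hG.dP_s hφ hs hq, neg_div, neg_div, neg_div, neg_neg,
      div_div_div_cancel_right₀ hρ]
    simp [hρ]
  exact (forall₂_congr h).trans (Set.forall_mem_image (f := fun q : ℝ × ℝ => q.2 / q.1)
    (s := G.domain) (p := fun t => deriv φ t ≠ 0 ∧ χ t = (k + t * deriv φ t) / deriv φ t)).symm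

/-- An ideal gas satisfies the compressibility conditions if and only if the square of its speed
of sound is a function of `p / ρ` that satisfies the ideal gas constraints. -/
theorem IsIdealGas.satisfiesH1H2_iff (hG : G.IsIdealGas k) (hk : 0 < k) :
    G.SatisfiesH1H2 ↔ ∃ χ : ℝ → ℝ, G.HasSqSoundSpeed (fun q => χ (q.2 / q.1)) ∧
      IdealGasConstraints χ G.ratios := by
  obtain ⟨φ, hφ, hs⟩ := hG.exists_entropy_profile hk
  rw [hG.satisfiesH1H2_iff_profile hk hφ hs]
  simp only [hG.hasSqSoundSpeed_iff_profile hφ hs]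
  have hopen := hG.isOpen_ratios
  have hdφ : ∀ t ∈ G.ratios, ContDiffAt ℝ ∞ (deriv φ) t := fun t ht =>
    ContDiffAt.clm_apply ((hφ t ht).fderiv_right (m := ∞) (by simp)) contDiffAt_const
  constructor
  · intro h
    have hd0 : ∀ t ∈ G.ratios, deriv φ t ≠ 0 := by
      intro t ht h0
      have := (h t ht).2.1
      rw [invSqSound, h0, zero_div] at this
      linarith
    refine ⟨fun t => (k + t * deriv φ t) / deriv φ t, fun t ht => ⟨hd0 t ht, rfl⟩, ?_, ?_⟩
    · intro t ht
      exact ((contDiffAt_const.add (contDiffAt_id.mul (hdφ t ht))).div (hdφ t ht)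
        (hd0 t ht)).contDiffWithinAt
    · intro t ht
      obtain ⟨h1, h2, h3, h4⟩ := h t ht
      have htpos := hG.ratios_pos hk ht
      have hinv : (fun t => (k + t * deriv φ t) / deriv φ t) = fun t => (invSqSound k φ t)⁻¹ := by
        funext t; rw [invSqSound, inv_div]
      have hψd : DifferentiableAt ℝ (invSqSound k φ) t :=
        ((hdφ t ht).div (contDiffAt_const.add (contDiffAt_id.mul (hdφ t ht))) h1).differentiableAt
          (by simp)
      have hψpos : 0 < invSqSound k φ t := by linarith
      have hψ : invSqSound k φ t * (k + t * deriv φ t) = deriv φ t := div_mul_cancel₀ _ h1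
      rw [hinv, (hψd.hasDerivAt.fun_inv hψpos.ne').deriv]
      -- As `k ψ > 0`, this forces `t ψ ≠ 1`, that is `χ ≠ π`.
      have hk1 : k * invSqSound k φ t = (1 - t * invSqSound k φ t) * deriv φ t := by
        linear_combination hψ
      have hk2 : 1 / (k + t * deriv φ t) = (1 - t * invSqSound k φ t) / k := by
        rw [div_eq_div_iff h1 hk.ne']
        linear_combination t * hψ
      rw [hk2, ← add_div] at h3
      have h5 := (div_pos_iff_of_pos_right hk).1 h3
      beta_reduce
      generalize deriv (invSqSound k φ) t = b at *
      generalize invSqSound k φ t = ψ at *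
      refine ⟨?_, ?_, ?_, ?_⟩
      · intro h0
        have : 1 - t * ψ = 0 := by rw [← h0, inv_mul_cancel₀ hψpos.ne', sub_self]
        rw [this, zero_mul] at hk1
        exact (mul_pos hk hψpos).ne' hk1
      · rw [div_lt_iff₀ (by linarith), inv_mul_eq_div, lt_div_iff₀ hψpos]
        linarith
      · exact inv_lt_one_of_one_lt₀ h2
      · have : (1 + t) * (ψ⁻¹ - t) * (-b / ψ ^ 2) + 2 * ψ⁻¹ * (1 - ψ⁻¹) =
            (-b * (1 - t * ψ) * (1 + t) - 2 * (1 - ψ) * ψ) / ψ ^ 3 := by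
          field_simp; ring
        rw [this]
        exact div_pos h4 (pow_pos hψpos 3)
  · rintro ⟨χ, hχ, hχs, hχc⟩ t ht
    obtain ⟨h1, h2, h3, h4⟩ := hχc t ht
    obtain ⟨hd0, hχt⟩ := hχ t ht
    have htpos := hG.ratios_pos hk ht
    have hχpos : 0 < χ t := (div_pos htpos (by linarith)).trans h2
    -- The set of ratios is open, so the equality with `1/χ` passes to derivatives.
    have hev : invSqSound k φ =ᶠ[𝓝 t] fun t => (χ t)⁻¹ := by
      filter_upwards [hopen.mem_nhds ht] with z hz
      rw [(hχ z hz).2, inv_div, invSqSound]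
    have hχd : DifferentiableAt ℝ χ t :=
      (hχs.contDiffAt (hopen.mem_nhds ht)).differentiableAt (by simp)
    have hsum : k + t * deriv φ t = χ t * deriv φ t := by rw [hχt]; field_simp
    rw [hev.deriv_eq, (hχd.hasDerivAt.fun_inv hχpos.ne').deriv, hev.eq_of_nhds, hsum]
    refine ⟨mul_ne_zero hχpos.ne' hd0, (one_lt_inv₀ hχpos).2 h3, ?_, ?_⟩
    · have : 2 * t / k + 1 / (χ t * deriv φ t) = (2 * t * χ t + (χ t - t)) / (k * χ t) := by
        have hk1 : (χ t - t) * deriv φ t = k := by linarith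
        rw [← hk1]
        have : χ t - t ≠ 0 := sub_ne_zero.2 h1
        field_simp
      rw [this]
      rw [div_lt_iff₀ (by linarith)] at h2
      exact div_pos (by linarith) (mul_pos hk hχpos)
    · have : -(-deriv χ t / χ t ^ 2) * (1 - t * (χ t)⁻¹) * (1 + t) - 2 * (1 - (χ t)⁻¹) * (χ t)⁻¹ =
          ((1 + t) * (χ t - t) * deriv χ t + 2 * χ t * (1 - χ t)) / χ t ^ 3 := by
        field_simp; ring
      rw [this]
      exact div_pos h4 (pow_pos hχpos 3)

end StateFunctions

end Compressibility

/-! ### Construction of a gas from its speed of sound -/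

section Construction

open Filter Topology

/-- A continuous function on an open set of reals has a primitive there. -/
theorem exists_primitive {J : Set ℝ} (hJ : IsOpen J) {f : ℝ → ℝ} (hf : ContinuousOn f J) :
    ∃ F : ℝ → ℝ, ∀ t ∈ J, HasDerivAt F (f t) t := by
  classical
  -- The base point depends only on the component, so it is locally constant on `J`; the value `0`
  -- serves points outside `J`, whose component is empty.
  let c : Set ℝ → ℝ := fun C => if h : C.Nonempty then h.some else 0
  refine ⟨fun t => ∫ x in c (connectedComponentIn J t)..t, f x, fun t₀ ht₀ => ?_⟩
  set C := connectedComponentIn J t₀ with hC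
  have hCne : C.Nonempty := ⟨t₀, mem_connectedComponentIn ht₀⟩
  have hcC : c C ∈ C := by
    simp only [c, dif_pos hCne]
    exact hCne.some_mem
  have hCJ : C ⊆ J := connectedComponentIn_subset J t₀
  have hsub : Set.uIcc (c C) t₀ ⊆ C :=
    isPreconnected_connectedComponentIn.ordConnected.uIcc_subset hcC
      (mem_connectedComponentIn ht₀)
  have hint : IntervalIntegrable f MeasureTheory.volume (c C) t₀ :=
    (hf.mono (hsub.trans hCJ)).intervalIntegrable
  have h := intervalIntegral.integral_hasDerivAt_right hint
    (hf.stronglyMeasurableAtFilter hJ t₀ ht₀) (hf.continuousAt (hJ.mem_nhds ht₀))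
  refine h.congr_of_eventuallyEq ?_
  filter_upwards [hJ.connectedComponentIn.mem_nhds (mem_connectedComponentIn ht₀)] with t ht
  rw [← connectedComponentIn_eq ht]

theorem exists_smooth_primitive {J : Set ℝ} (hJ : IsOpen J) {f : ℝ → ℝ}
    (hf : ContDiffOn ℝ ∞ f J) :
    ∃ F : ℝ → ℝ, (∀ t ∈ J, HasDerivAt F (f t) t) ∧ ContDiffOn ℝ ∞ F J := by
  obtain ⟨F, hF⟩ := exists_primitive hJ hf.continuousOn
  refine ⟨F, hF, ?_⟩
  rw [contDiffOn_infty_iff_deriv_of_isOpen hJ]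
  exact ⟨fun t ht => (hF t ht).differentiableAt.differentiableWithinAt,
    hf.congr fun t ht => (hF t ht).deriv⟩

theorem IdealGasConstraints.mono {χ : ℝ → ℝ} {J J' : Set ℝ} (h : IdealGasConstraints χ J)
    (hJ : J' ⊆ J) : IdealGasConstraints χ J' :=
  ⟨h.1.mono hJ, fun t ht => h.2 t (hJ ht)⟩

/-- The states of positive energy density with `p / ρ` in a given set. -/
def cone (J : Set ℝ) : Set (ℝ × ℝ) := {q | 0 < q.1 ∧ q.2 / q.1 ∈ J}

theorem isOpen_cone {J : Set ℝ} (hJ : IsOpen J) : IsOpen (cone J) := by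
  have hpos : IsOpen {q : ℝ × ℝ | 0 < q.1} := isOpen_lt continuous_const continuous_fst
  have hc : ContinuousOn (fun q : ℝ × ℝ => q.2 / q.1) {q : ℝ × ℝ | 0 < q.1} :=
    continuousOn_snd.div continuousOn_fst fun q hq => ne_of_gt hq
  exact hc.isOpen_inter_preimage hpos hJ

theorem isPreconnected_cone_ray (J : Set ℝ) (c : ℝ) :
    IsPreconnected {q : ℝ × ℝ | q ∈ cone J ∧ q.2 = c * q.1} := by
  by_cases hc : c ∈ J
  · have : {q : ℝ × ℝ | q ∈ cone J ∧ q.2 = c * q.1} = (fun a : ℝ => (a, c * a)) '' Set.Ioi 0 := by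
      ext ⟨a, b⟩
      constructor
      · rintro ⟨⟨ha, -⟩, hb⟩
        exact ⟨a, ha, by rw [show b = c * a from hb]⟩
      · rintro ⟨a', ha, he⟩
        obtain ⟨rfl, rfl⟩ := Prod.mk.inj he
        have ha' : a' ≠ 0 := ne_of_gt ha
        exact ⟨⟨ha, by simpa [ha'] using hc⟩, rfl⟩
    rw [this]
    exact isPreconnected_Ioi.image _ (by fun_prop)
  · have : {q : ℝ × ℝ | q ∈ cone J ∧ q.2 = c * q.1} = ∅ := by
      refine Set.eq_empty_of_forall_notMem ?_
      rintro ⟨a, b⟩ ⟨⟨ha, hJ⟩, hb⟩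
      have ha' : a ≠ 0 := ne_of_gt ha
      simp only at hb hJ
      rw [hb, mul_div_cancel_right₀ _ ha'] at hJ
      exact hc hJ
    rw [this]
    exact isPreconnected_empty

/-- The ideal gas with entropy `φ(p / ρ) - k log ρ` and matter density `ρ exp(ℓ(p / ρ))`. -/
noncomputable def gasOfProfile (k : ℝ) (J : Set ℝ) (φ ℓ : ℝ → ℝ) : StateFunctions where
  domain := cone J
  r q := q.1 * Real.exp (ℓ (q.2 / q.1))
  s q := φ (q.2 / q.1) - k * Real.log q.1
  Θ q := q.2 / (k * (q.1 * Real.exp (ℓ (q.2 / q.1))))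

theorem contDiffOn_comp_ratio {J : Set ℝ} {f : ℝ → ℝ} (hf : ContDiffOn ℝ ∞ f J) :
    ContDiffOn ℝ ∞ (fun q : ℝ × ℝ => f (q.2 / q.1)) (cone J) :=
  hf.comp (contDiffOn_snd.div contDiffOn_fst fun _ hq => hq.1.ne') fun _ hq => hq.2

/-- `h` is the `dp` component of `(p/k) ds + (ρ + p) d(log r) = dρ`, and it implies the `dρ`
component. `Θ` is defined by the equation of state. -/
theorem isIdealGas_gasOfProfile {k : ℝ} (hk : 0 < k) {J : Set ℝ} (hJ : IsOpen J)
    (hJpos : J ⊆ Set.Ioi 0) {φ ℓ φ' ℓ' : ℝ → ℝ} (hφ : ContDiffOn ℝ ∞ φ J)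
    (hℓ : ContDiffOn ℝ ∞ ℓ J) (hφ' : ∀ t ∈ J, HasDerivAt φ (φ' t) t)
    (hℓ' : ∀ t ∈ J, HasDerivAt ℓ (ℓ' t) t)
    (h : ∀ t ∈ J, k * (1 + t) * ℓ' t = - t * φ' t) :
    (gasOfProfile k J φ ℓ).IsIdealGas k := by
  have hr : ∀ q ∈ cone J, 0 < q.1 * Real.exp (ℓ (q.2 / q.1)) := fun q hq =>
    mul_pos hq.1 (Real.exp_pos _)
  have hp : ∀ q ∈ cone J, 0 < q.2 := fun q hq => by
    have := hJpos hq.2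
    rwa [Set.mem_Ioi, div_pos_iff_of_pos_right hq.1] at this
  have hrs : ContDiffOn ℝ ∞ (fun q : ℝ × ℝ => q.1 * Real.exp (ℓ (q.2 / q.1))) (cone J) :=
    contDiffOn_fst.mul (contDiffOn_comp_ratio hℓ).exp
  refine ⟨⟨isOpen_cone hJ, hrs, ?_, ?_, fun q hq => hq.1, hr, ?_, ?_⟩, ?_,
    isPreconnected_cone_ray J⟩
  · exact (contDiffOn_comp_ratio hφ).sub
      (contDiffOn_const.mul (contDiffOn_fst.log fun q hq => hq.1.ne'))
  · exact contDiffOn_snd.div (contDiffOn_const.mul hrs) fun q hq => (mul_pos hk (hr q hq)).ne'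
  · exact fun q hq => div_pos (hp q hq) (mul_pos hk (hr q hq))
  · intro q hq
    have hρ := hq.1.ne'
    have hs : HasFDerivAt (gasOfProfile k J φ ℓ).s _ q :=
      (hasFDerivAt_comp_ratio hρ (hφ' _ hq.2)).fun_sub
        (((hasFDerivAt_fst (𝕜 := ℝ) (p := q)).log hρ).const_mul k)
    have hrd : HasFDerivAt (gasOfProfile k J φ ℓ).r _ q :=
      (hasFDerivAt_fst (𝕜 := ℝ) (p := q)).fun_mul (hasFDerivAt_comp_ratio hρ (hℓ' _ hq.2)).exp
    rw [StateFunctions.fderiv_energy_add_vol (hr q hq).ne' hrd.differentiableAt, hs.fderiv,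
      hrd.fderiv]
    have h1 := h _ hq.2
    have hpq := hp q hq
    have h1pos : 0 < 1 + q.2 / q.1 := by
      have := hJpos hq.2
      rw [Set.mem_Ioi] at this
      linarith
    simp only [gasOfProfile]
    have h2 : ℓ' (q.2 / q.1) = -(q.2 / q.1) * φ' (q.2 / q.1) / (k * (1 + q.2 / q.1)) := by
      rw [eq_div_iff (mul_pos hk h1pos).ne', ← h1]
      ring
    rw [h2]
    generalize φ' (q.2 / q.1) = a
    generalize hE : Real.exp (ℓ (q.2 / q.1)) = E
    have hEpos : 0 < E := hE ▸ Real.exp_pos _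
    have hsum : q.1 + q.2 ≠ 0 := (add_pos hq.1 hpq).ne'
    ext
    · simp
      field_simp
      ring
    · simp
      field_simp
  · intro q hq
    have := (hr q hq).ne'
    simp only [gasOfProfile]
    generalize q.1 * Real.exp (ℓ (q.2 / q.1)) = r at this ⊢
    field_simp

theorem exists_idealGas {k : ℝ} (hk : 0 < k) {J : Set ℝ} (hJ : IsOpen J)
    (hJpos : J ⊆ Set.Ioi 0) {χ : ℝ → ℝ} (hχ : IdealGasConstraints χ J) :
    ∃ G : StateFunctions, G.IsIdealGas k ∧ G.domain = cone J ∧ G.SatisfiesH1H2 ∧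
      G.HasSqSoundSpeed (fun q => χ (q.2 / q.1)) := by
  have hne : ∀ t ∈ J, χ t - t ≠ 0 := fun t ht => sub_ne_zero.2 (hχ.2 t ht).1
  have h1 : ∀ t ∈ J, 1 + t ≠ 0 := fun t ht => by
    have := hJpos ht
    rw [Set.mem_Ioi] at this
    linarith
  -- Solves `χ = π + k/φ'` for `φ'`; the next integrand is the `ℓ'` that the energy balance then
  -- dictates.
  obtain ⟨φ, hφ, hφs⟩ := exists_smooth_primitive hJ (f := fun t => k / (χ t - t))
    (contDiffOn_const.div (hχ.1.sub contDiffOn_id) hne)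
  obtain ⟨ℓ, hℓ, hℓs⟩ := exists_smooth_primitive hJ (f := fun t => -t / ((χ t - t) * (1 + t)))
    (contDiffOn_id.neg.div ((hχ.1.sub contDiffOn_id).mul (contDiffOn_const.add contDiffOn_id))
      fun t ht => mul_ne_zero (hne t ht) (h1 t ht))
  have hG := isIdealGas_gasOfProfile hk hJ hJpos hφs hℓs hφ hℓ fun t ht => by
    have := hne t ht
    have := h1 t ht
    field_simp
  have hratios : (gasOfProfile k J φ ℓ).ratios ⊆ J := by
    rintro _ ⟨q, hq, rfl⟩
    exact hq.2
  have hspeed : (gasOfProfile k J φ ℓ).HasSqSoundSpeed (fun q => χ (q.2 / q.1)) := by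
    rw [hG.hasSqSoundSpeed_iff_profile
      (fun t ht => hφs.contDiffAt (hJ.mem_nhds (hratios ht))) (fun q _ => rfl)]
    intro t ht
    have hn := hne t (hratios ht)
    rw [(hφ t (hratios ht)).deriv]
    refine ⟨div_ne_zero hk.ne' hn, ?_⟩
    field_simp
    ring
  exact ⟨_, hG, rfl, (hG.satisfiesH1H2_iff hk).2 ⟨χ, hspeed, hχ.mono hratios⟩, hspeed⟩

/-- A function that satisfies the ideal gas constraints for all positive values of `p / ρ`. -/
theorem exists_idealGasConstraints : ∃ χ : ℝ → ℝ, IdealGasConstraints χ (Set.Ioi 0) := by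
  have hpos : ∀ t ∈ Set.Ioi (0 : ℝ), 0 < 3 * t + 2 := fun t ht => by
    rw [Set.mem_Ioi] at ht
    linarith
  -- Here `1/χ = 1/π + 3/2`. A function with `1/χ = 1/π + a` satisfies the constraints for all `π >
  -- 0` exactly when `3/2 ≤ a < 2`.
  refine ⟨fun t => 2 * t / (3 * t + 2), ?_, fun t ht => ?_⟩
  · exact (contDiffOn_const.mul contDiffOn_id).div
      ((contDiffOn_const.mul contDiffOn_id).add contDiffOn_const) fun t ht => (hpos t ht).ne'
  · have h := hpos t ht
    rw [Set.mem_Ioi] at ht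
    have hd : HasDerivAt (fun t : ℝ => 2 * t / (3 * t + 2)) (4 / (3 * t + 2) ^ 2) t := by
      have h1 : HasDerivAt (fun t : ℝ => 2 * t) 2 t := by
        simpa using (hasDerivAt_id t).const_mul 2
      have h2 : HasDerivAt (fun t : ℝ => 3 * t + 2) 3 t := by
        simpa using ((hasDerivAt_id t).const_mul 3).add_const 2
      refine (h1.fun_div h2 h.ne').congr_deriv ?_
      congr 1
      ring
    rw [hd.deriv]
    refine ⟨?_, ?_, ?_, ?_⟩
    · rw [Ne, div_eq_iff h.ne']
      nlinarith
    · rw [div_lt_div_iff₀ (by linarith) h]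
      nlinarith
    · rw [div_lt_one h]
      linarith
    · have : (1 + t) * (2 * t / (3 * t + 2) - t) * (4 / (3 * t + 2) ^ 2)
          + 2 * (2 * t / (3 * t + 2)) * (1 - 2 * t / (3 * t + 2)) =
          (20 * t ^ 2 + 16 * t) / (3 * t + 2) ^ 3 := by
        field_simp
        ring
      rw [this]
      positivity

end Construction

/-! ### Adiabatic evolutions -/

section Evolution

namespace PerfectEnergyTensor

variable {M : Type*} [TopologicalSpace M] [ChartedSpace E4 M] [IsManifold (𝓡 4) ∞ M]
  {g : LorentzMetric M} {T : PerfectEnergyTensor M g} {G : StateFunctions} {k : ℝ}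

theorem dot_entropy (hG : G.IsIdealGas k) (hD : ∀ x, T.state x ∈ G.domain) (x : M) :
    dot T.u (fun y => G.s (T.state y)) x =
      dRho G.s (T.state x) * dot T.u T.ρ x + dP G.s (T.state x) * dot T.u T.p x :=
  T.dot_comp_state T.u ((hG.contDiffAt_s (hD x)).differentiableAt (by simp))

/-- Matter conservation follows from the energy equation for an adiabatic evolution. -/
theorem isEvolutionOf_of_adiabatic (hG : G.IsIdealGas k) (hk : 0 < k)
    (hD : ∀ x, T.state x ∈ G.domain)
    (hs : ∀ x, dot T.u (fun y => G.s (T.state y)) x = 0) : T.IsEvolutionOf G := by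
  refine ⟨hD, fun x => ?_, hs⟩
  have hr := hG.r_pos _ (hD x)
  have hrd := (hG.contDiffAt_r (hD x)).differentiableAt (by simp)
  have hb := hG.balance_log hk (hD x)
  have hen := T.energy_equation x
  have hsx := (dot_entropy hG hD x).symm.trans (hs x)
  rw [T.dot_comp_state T.u hrd]
  rw [(hrd.hasFDerivAt.log hr.ne').fderiv] at hb
  have h1 := congrArg (fun L : ℝ × ℝ →L[ℝ] ℝ => L (1, 0)) hb
  have h2 := congrArg (fun L : ℝ × ℝ →L[ℝ] ℝ => L (0, 1)) hb
  simp [← dRho.eq_def, ← dP.eq_def] at h1 h2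
  have hsum : 0 < T.ρ x + T.p x := add_pos (T.ρ_pos x) (T.p_pos x)
  have hst1 : (T.state x).1 = T.ρ x := rfl
  have hst2 : (T.state x).2 = T.p x := rfl
  rw [hst1, hst2] at h1 h2
  field_simp at h1 h2
  refine (mul_eq_zero.1 ?_).resolve_left (mul_pos hsum hk).ne'
  -- The balance evaluated on `u` reads `(p/k) ṡ + (ρ + p) ṙ/r = ρ̇`, and the energy equation
  -- replaces `ρ̇` by `-(ρ + p)θ`.
  linear_combination (dot T.u T.ρ x) * h1 + dot T.u T.p x * h2
    - T.p x * G.r (T.state x) * hsx + k * G.r (T.state x) * hen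

theorem state_mem_cone {J : Set ℝ} (hJ : Set.range T.pi ⊆ J) (x : M) : T.state x ∈ cone J :=
  ⟨T.ρ_pos x, hJ ⟨x, rfl⟩⟩

theorem range_pi_subset_ratios (hD : ∀ x, T.state x ∈ G.domain) : Set.range T.pi ⊆ G.ratios := by
  rintro _ ⟨x, rfl⟩
  exact ⟨_, hD x, rfl⟩

theorem range_pi_pos : Set.range T.pi ⊆ Set.Ioi 0 := by
  rintro _ ⟨x, rfl⟩
  exact div_pos (T.p_pos x) (T.ρ_pos x)

end PerfectEnergyTensor

end Evolution

end RelFluid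

/-! ### The characterization -/

open RelFluid in
theorem theorem8 {M : Type*} [TopologicalSpace M] [ChartedSpace E4 M]
    [IsManifold (𝓡 4) ∞ M] (g : LorentzMetric M) (T : PerfectEnergyTensor M g)
    (hT : T.NonBarotropic) (k : ℝ) (hk : 0 < k) :
    (T.NonIsoenergetic →
      (T.RepresentsIdealGas k ↔
        ∃ χ : ℝ → ℝ, (∀ x, T.indicatrix x = χ (T.pi x)) ∧
          IdealGasConstraints χ (Set.range T.pi))) ∧
    (T.Isoenergetic →
      (T.RepresentsIdealGas k ↔ T.Isobaroenergetic) ∧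
      (T.Isobaroenergetic → ∀ G : StateFunctions, G.IsIdealGas k →
        ((G.SatisfiesH1H2 ∧ T.IsEvolutionOf G) ↔
          ((∀ x, T.state x ∈ G.domain) ∧
            ∃ χ : ℝ → ℝ, G.HasSqSoundSpeed (fun q => χ (q.2 / q.1)) ∧
              IdealGasConstraints χ ((fun q : ℝ × ℝ => q.2 / q.1) '' G.domain))))) := by
  have adiabatic_of_iso : T.Isobaroenergetic → ∀ G : StateFunctions, G.IsIdealGas k →
      (∀ x, T.state x ∈ G.domain) → T.IsEvolutionOf G := fun hiso G hG hD =>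
    PerfectEnergyTensor.isEvolutionOf_of_adiabatic hG hk hD fun x => by
      rw [PerfectEnergyTensor.dot_entropy hG hD, (hiso x).1, (hiso x).2, mul_zero, mul_zero,
        add_zero]
  refine ⟨fun hnon => ⟨?_, ?_⟩, fun hiso => ⟨⟨?_, ?_⟩, fun hisob G hG => ?_⟩⟩
  · rintro ⟨G, hG, hH, hE⟩
    obtain ⟨χ, hχ, hc⟩ := (hG.satisfiesH1H2_iff hk).1 hH
    refine ⟨χ, fun x => ?_, hc.mono (PerfectEnergyTensor.range_pi_subset_ratios hE.state_mem)⟩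
    obtain ⟨hne, heq⟩ := hχ _ (hE.state_mem x)
    have hs := (PerfectEnergyTensor.dot_entropy hG hE.state_mem x).symm.trans (hE.adiabatic x)
    refine Eq.trans ?_ heq.symm
    rw [PerfectEnergyTensor.indicatrix, div_eq_div_iff (hnon x) hne]
    linear_combination hs
  · rintro ⟨χ, hχ, hc⟩
    -- The gas lives on the full cone over the range of `π`, which contains every state of `T`.
    obtain ⟨G, hG, hGD, hH, hspeed⟩ := exists_idealGas hk (T.isOpen_range_pi hT)
      PerfectEnergyTensor.range_pi_pos hc
    have hD : ∀ x, T.state x ∈ G.domain := fun x => by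
      rw [hGD]
      exact PerfectEnergyTensor.state_mem_cone subset_rfl x
    refine ⟨G, hG, hH, PerfectEnergyTensor.isEvolutionOf_of_adiabatic hG hk hD fun x => ?_⟩
    obtain ⟨hne, heq⟩ := hspeed _ (hD x)
    have h := (hχ x).trans heq
    rw [PerfectEnergyTensor.indicatrix, div_eq_div_iff (hnon x) hne] at h
    rw [PerfectEnergyTensor.dot_entropy hG hD]
    linear_combination h
  · rintro ⟨G, hG, hH, hE⟩ x
    obtain ⟨χ, hχ, -⟩ := (hG.satisfiesH1H2_iff hk).1 hH
    have hs := (PerfectEnergyTensor.dot_entropy hG hE.state_mem x).symm.trans (hE.adiabatic x)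
    rw [hiso x, mul_zero, zero_add] at hs
    -- With `ρ̇ = 0`, adiabaticity is `s'_p ṗ = 0`, and `s'_p ≠ 0` because the speed of sound is
    -- defined.
    exact ⟨hiso x, (mul_eq_zero.1 hs).resolve_left (hχ _ (hE.state_mem x)).1⟩
  · intro hisob
    -- Every function of state is constant along `u` here, so any admissible gas defined for all `π
    -- > 0` will do.
    obtain ⟨χ, hχ⟩ := exists_idealGasConstraints
    obtain ⟨G, hG, hGD, hH, -⟩ := exists_idealGas hk isOpen_Ioi subset_rfl hχ
    refine ⟨G, hG, hH, adiabatic_of_iso hisob G hG fun x => ?_⟩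
    rw [hGD]
    exact PerfectEnergyTensor.state_mem_cone PerfectEnergyTensor.range_pi_pos x
  · rw [hG.satisfiesH1H2_iff hk]
    exact ⟨fun h => ⟨h.2.state_mem, h.1⟩, fun h => ⟨h.2, adiabatic_of_iso hisob G hG h.1⟩⟩
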